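/- Let $R$ be a commutative unital ring. Let $\mathcal{E}=(\mathcal{E}^0,\mathcal{E}^1,r,s)$ be a directed graph (with arbitrary sets of vertices and edges) with no sinks, i.e. every vertex emits an edge, and with no vertex that is simultaneously a source (receives no edge) and an infinite emitter (emits infinitely many edges). Let $\mathsf{X}\subseteq(\mathcal{E}^1)^{\mathbb{N}}$ be the one-sided edge subshift of $\mathcal{E}$, i.e. the set of all sequences of edges containing no word $ef$ with $r(e)\neq s(f)$ (the infinite paths of $\mathcal{E}$). Then there is an isomorphism of (possibly non-unital) $R$-algebras $$\mathcal{A}_R(\mathsf{X})\cong L_R(\mathcal{E}),$$ where the two algebras are defined as follows. *The subshift algebra.* Let $\mathcal{L}_{\mathsf{X}}$ be the set of finite words occurring in elements of $\mathsf{X}$, and let $\omega$ be the empty word. For $\alpha,\beta\in\mathcal{L}_{\mathsf{X}}$ put $C(\alpha,\beta)=\{\beta x\in\mathsf{X}:\alpha x\in\mathsf{X}\}$. Let $\mathcal{B}$ be the smallest family of subsets of $\mathsf{X}$ that contains $\emptyset$ and all $C(\alpha,\beta)$ with $\alpha,\beta\in\mathcal{L}_{\mathsf{X}}$ not both equal to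 $\omega$, and is closed under finite unions, finite intersections and relative complements (it need not contain $\mathsf{X}$). Then $\mathcal{A}_R(\mathsf{X})$ is the universal associative, not necessarily unital, $R$-algebra with generators $\{p_A:A\in\mathcal{B}\}\cup\{s_a,s_a^*:a\in\mathcal{E}^1\}$ subject to: (i) $p_{A\cap B}=p_Ap_B$, $p_{A\cup B}=p_A+p_B-p_{A\cap B}$ and $p_\emptyset=0$ for all $A,B\in\mathcal{B}$; (ii) $s_as_a^*s_a=s_a$ and $s_a^*s_as_a^*=s_a^*$ for all $a\in\mathcal{E}^1$; (iii) $s_\beta s_\alpha^*s_\alpha s_\beta^*=p_{C(\alpha,\beta)}$ for all $\alpha,\beta\in\mathcal{L}_{\mathsf{X}}\setminus\{\omega\}$; (iv) $s_\alpha^*s_\alpha=p_{C(\alpha,\omega)}$ for all $\alpha\in\mathcal{L}_{\mathsf{X}}\setminus\{\omega\}$; (v) $s_\beta s_\beta^*=p_{C(\omega,\beta)}$ for all $\beta\in\mathcal{L}_{\mathsf{X}}\setminus\{\omega\}$; where $s_\alpha=s_{\alpha_1}\cdots s_{\alpha_n}$ and $s_\alpha^*=s_{\alpha_n}^*\cdots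 s_{\alpha_1}^*$ for $\alpha=\alpha_1\cdots\alpha_n$. *The Leavitt path algebra.* $L_R(\mathcal{E})$ is the universal associative, not necessarily unital, $R$-algebra with generators $\{v:v\in\mathcal{E}^0\}\cup\{e,e^*:e\in\mathcal{E}^1\}$ subject to: $vv'=\delta_{v,v'}v$ for $v,v'\in\mathcal{E}^0$; $s(e)e=er(e)=e$ and $r(e)e^*=e^*s(e)=e^*$ for $e\in\mathcal{E}^1$; $e^*e'=\delta_{e,e'}r(e)$ for $e,e'\in\mathcal{E}^1$; and $v=\sum_{e:\,s(e)=v}ee^*$ for every $v\in\mathcal{E}^0$ with $0<|s^{-1}(v)|<\infty$. -/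

import Mathlib

/-! ### Universal (possibly non-unital) algebras given by generators and relations -/

/-- The free associative, not necessarily unital, `R`-algebra on a set `G` of generators. -/
abbrev FreeNonUnitalAlg (R G : Type*) [CommRing R] : Type _ := MonoidAlgebra R (FreeSemigroup G)

/-- A generator, as an element of the free non-unital algebra. -/
noncomputable def FreeNonUnitalAlg.of (R : Type*) {G : Type*} [CommRing R] (g : G) :
    FreeNonUnitalAlg R G :=
  MonoidAlgebra.ofMagma R (FreeSemigroup G) (FreeSemigroup.of g)

/-- The two-sided (`R`-linear) ideal generated by all `x - y`, where `rel x y` is one of the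
relations. -/
noncomputable def relIdeal {R G : Type*} [CommRing R]
    (rel : FreeNonUnitalAlg R G → FreeNonUnitalAlg R G → Prop) :
    Submodule R (FreeNonUnitalAlg R G) :=
  sInf {J | (∀ x y, rel x y → x - y ∈ J) ∧ ∀ a, ∀ x ∈ J, a * x ∈ J ∧ x * a ∈ J}

theorem sub_mem_relIdeal {R G : Type*} [CommRing R]
    {rel : FreeNonUnitalAlg R G → FreeNonUnitalAlg R G → Prop} {x y : FreeNonUnitalAlg R G}
    (h : rel x y) : x - y ∈ relIdeal rel :=
  (Submodule.mem_sInf).2 fun _ hJ => hJ.1 x y h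

theorem mul_mem_relIdeal_left {R G : Type*} [CommRing R]
    {rel : FreeNonUnitalAlg R G → FreeNonUnitalAlg R G → Prop} (a : FreeNonUnitalAlg R G)
    {x : FreeNonUnitalAlg R G} (h : x ∈ relIdeal rel) : a * x ∈ relIdeal rel :=
  (Submodule.mem_sInf).2 fun J hJ => (hJ.2 a x ((Submodule.mem_sInf).1 h J hJ)).1

theorem mul_mem_relIdeal_right {R G : Type*} [CommRing R]
    {rel : FreeNonUnitalAlg R G → FreeNonUnitalAlg R G → Prop} (a : FreeNonUnitalAlg R G)
    {x : FreeNonUnitalAlg R G} (h : x ∈ relIdeal rel) : x * a ∈ relIdeal rel :=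
  (Submodule.mem_sInf).2 fun J hJ => (hJ.2 a x ((Submodule.mem_sInf).1 h J hJ)).2

/-- The universal `R`-algebra (associative, not necessarily unital) with generators `G` subject to
the relations `rel`. -/
def UniversalAlg {R G : Type*} [CommRing R]
    (rel : FreeNonUnitalAlg R G → FreeNonUnitalAlg R G → Prop) : Type _ :=
  FreeNonUnitalAlg R G ⧸ relIdeal rel

namespace UniversalAlg

variable {R G : Type*} [CommRing R] (rel : FreeNonUnitalAlg R G → FreeNonUnitalAlg R G → Prop)

noncomputable instance instAddCommGroup : AddCommGroup (UniversalAlg rel) :=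
  inferInstanceAs (AddCommGroup (FreeNonUnitalAlg R G ⧸ relIdeal rel))

noncomputable instance instModule : Module R (UniversalAlg rel) :=
  inferInstanceAs (Module R (FreeNonUnitalAlg R G ⧸ relIdeal rel))

/-- The quotient map from the free algebra, as a linear map. -/
noncomputable def mkLin : FreeNonUnitalAlg R G →ₗ[R] UniversalAlg rel := (relIdeal rel).mkQ

theorem mkLin_surjective : Function.Surjective (mkLin rel) := (relIdeal rel).mkQ_surjective

theorem mkLin_eq_iff {x y : FreeNonUnitalAlg R G} :
    mkLin rel x = mkLin rel y ↔ x - y ∈ relIdeal rel :=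
  Submodule.Quotient.eq (relIdeal rel)

noncomputable instance instMul : Mul (UniversalAlg rel) where
  mul := Quotient.map₂ (· * ·) (by
    intro a a' ha b b' hb
    have ha' : a - a' ∈ relIdeal rel := (Submodule.quotientRel_def _).1 ha
    have hb' : b - b' ∈ relIdeal rel := (Submodule.quotientRel_def _).1 hb
    refine (Submodule.quotientRel_def _).2 ?_
    have h : a * b - a' * b' = (a - a') * b + a' * (b - b') := by
      rw [sub_mul, mul_sub]; abel
    rw [h]
    exact (relIdeal rel).add_mem (mul_mem_relIdeal_right b ha') (mul_mem_relIdeal_left a' hb'))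

theorem mkLin_mul (x y : FreeNonUnitalAlg R G) :
    mkLin rel (x * y) = mkLin rel x * mkLin rel y := rfl

noncomputable instance instNonUnitalRing : NonUnitalRing (UniversalAlg rel) where
  __ := instAddCommGroup rel
  __ := instMul rel
  left_distrib a b c := by
    obtain ⟨a, rfl⟩ := mkLin_surjective rel a
    obtain ⟨b, rfl⟩ := mkLin_surjective rel b
    obtain ⟨c, rfl⟩ := mkLin_surjective rel c
    exact congrArg (mkLin rel) (mul_add a b c)
  right_distrib a b c := by
    obtain ⟨a, rfl⟩ := mkLin_surjective rel a
    obtain ⟨b, rfl⟩ := mkLin_surjective rel b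
    obtain ⟨c, rfl⟩ := mkLin_surjective rel c
    exact congrArg (mkLin rel) (add_mul a b c)
  zero_mul a := by
    obtain ⟨a, rfl⟩ := mkLin_surjective rel a
    exact congrArg (mkLin rel) (zero_mul a)
  mul_zero a := by
    obtain ⟨a, rfl⟩ := mkLin_surjective rel a
    exact congrArg (mkLin rel) (mul_zero a)
  mul_assoc a b c := by
    obtain ⟨a, rfl⟩ := mkLin_surjective rel a
    obtain ⟨b, rfl⟩ := mkLin_surjective rel b
    obtain ⟨c, rfl⟩ := mkLin_surjective rel c
    exact congrArg (mkLin rel) (mul_assoc a b c)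

instance instIsScalarTower : IsScalarTower R (UniversalAlg rel) (UniversalAlg rel) where
  smul_assoc r a b := by
    obtain ⟨a, rfl⟩ := mkLin_surjective rel a
    obtain ⟨b, rfl⟩ := mkLin_surjective rel b
    exact congrArg (mkLin rel) (smul_mul_assoc r a b)

instance instSMulCommClass : SMulCommClass R (UniversalAlg rel) (UniversalAlg rel) where
  smul_comm r a b := by
    obtain ⟨a, rfl⟩ := mkLin_surjective rel a
    obtain ⟨b, rfl⟩ := mkLin_surjective rel b
    exact congrArg (mkLin rel) (mul_smul_comm r a b).symm

/-- The quotient map from the free algebra, as a homomorphism of algebras. -/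
noncomputable def mk : FreeNonUnitalAlg R G →ₙₐ[R] UniversalAlg rel where
  toFun := mkLin rel
  map_smul' := (mkLin rel).map_smul
  map_zero' := (mkLin rel).map_zero
  map_add' := (mkLin rel).map_add
  map_mul' := mkLin_mul rel

theorem mk_surjective : Function.Surjective (mk rel) := mkLin_surjective rel

/-- A generator, as an element of the universal algebra. -/
noncomputable def gen (g : G) : UniversalAlg rel := mk rel (FreeNonUnitalAlg.of R g)

/-- The relations hold in the universal algebra. -/
theorem mk_eq_of_rel {x y : FreeNonUnitalAlg R G} (h : rel x y) : mk rel x = mk rel y :=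
  (mkLin_eq_iff rel).2 (sub_mem_relIdeal h)

/-- Existence part of the universal property. -/
theorem exists_lift {S : Type*} [NonUnitalRing S] [Module R S] [IsScalarTower R S S]
    [SMulCommClass R S S] (f : G → S)
    (hf : ∀ x y, rel x y →
      MonoidAlgebra.liftMagma R (FreeSemigroup.lift f) x =
        MonoidAlgebra.liftMagma R (FreeSemigroup.lift f) y) :
    ∃ φ : UniversalAlg rel →ₙₐ[R] S, ∀ g, φ (gen rel g) = f g := by
  set F : FreeNonUnitalAlg R G →ₙₐ[R] S := MonoidAlgebra.liftMagma R (FreeSemigroup.lift f)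
    with hF
  have hle : relIdeal rel ≤ LinearMap.ker (F : FreeNonUnitalAlg R G →ₗ[R] S) := by
    refine sInf_le ⟨fun x y h => ?_, fun a x hx => ?_⟩
    · have h1 : F x = F y := hf x y h
      have h2 : F (x - y) = 0 := by rw [map_sub, h1, sub_self]
      exact LinearMap.mem_ker.2 h2
    · have hx' : F x = 0 := LinearMap.mem_ker.1 hx
      have h1 : F (a * x) = 0 := by rw [map_mul, hx', mul_zero]
      have h2 : F (x * a) = 0 := by rw [map_mul, hx', zero_mul]
      exact ⟨LinearMap.mem_ker.2 h1, LinearMap.mem_ker.2 h2⟩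
  let L : UniversalAlg rel →ₗ[R] S :=
    (relIdeal rel).liftQ (F : FreeNonUnitalAlg R G →ₗ[R] S) hle
  have hL : ∀ x, L (mkLin rel x) = F x := fun _ => rfl
  refine ⟨{ toFun := L
            map_smul' := L.map_smul
            map_zero' := L.map_zero
            map_add' := L.map_add
            map_mul' := fun a b => ?_ }, fun g => ?_⟩
  · obtain ⟨a, rfl⟩ := mkLin_surjective rel a
    obtain ⟨b, rfl⟩ := mkLin_surjective rel b
    change L (mkLin rel a * mkLin rel b) = L (mkLin rel a) * L (mkLin rel b)
    rw [← mkLin_mul, hL, hL, hL, map_mul]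
  · change F (FreeNonUnitalAlg.of R g) = f g
    rw [hF]
    simp [FreeNonUnitalAlg.of]

/-- Uniqueness part of the universal property. -/
theorem hom_ext {S : Type*} [NonUnitalRing S] [Module R S] [IsScalarTower R S S]
    [SMulCommClass R S S] {φ ψ : UniversalAlg rel →ₙₐ[R] S}
    (h : ∀ g, φ (gen rel g) = ψ (gen rel g)) : φ = ψ := by
  have h1 : φ.comp (mk rel) = ψ.comp (mk rel) := by
    refine MonoidAlgebra.nonUnitalAlgHom_ext' R (FreeSemigroup.hom_ext ?_)
    funext g
    exact h g
  ext x
  obtain ⟨x, rfl⟩ := mk_surjective rel x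
  exact DFunLike.congr_fun h1 x

end UniversalAlg

/-! ### One-sided subshifts over an arbitrary alphabet

Sequences in `𝒜^ℕ` are elements of `Stream' 𝒜`, words are elements of `List 𝒜`, the empty word
is `[]`, and `α ++ₛ x` is the concatenation of a word and a sequence. -/

/-- The subshift of all sequences in which no word of `F` occurs. -/
def subshift {𝒜 : Type*} (F : Set (List 𝒜)) : Set (Stream' 𝒜) :=
  {x | ∀ m n : ℕ, (x.drop m).take n ∉ F}

/-- The language of `X`: all finite initial words of sequences in `X` (for a subshift these are
all the words that occur in some sequence of `X`). -/
def language {𝒜 : Type*} (X : Set (Stream' 𝒜)) : Set (List 𝒜) :=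
  {α | ∃ x ∈ X, ∃ n : ℕ, x.take n = α}

/-- `C(α, β) = {β x ∈ X : α x ∈ X}`. -/
def relCyl {𝒜 : Type*} (X : Set (Stream' 𝒜)) (α β : List 𝒜) : Set (Stream' 𝒜) :=
  {y | ∃ x : Stream' 𝒜, y = β ++ₛ x ∧ β ++ₛ x ∈ X ∧ α ++ₛ x ∈ X}

/-- The Boolean algebra (with relative complements, possibly without a top element) of subsets of
`X` generated by the sets `C(α, β)`, with `α, β` in the language and not both empty. -/
inductive MemB {𝒜 : Type*} (X : Set (Stream' 𝒜)) : Set (Stream' 𝒜) → Prop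
  | relCyl (α β : List 𝒜) (hα : α ∈ language X) (hβ : β ∈ language X)
      (h : ¬ (α = [] ∧ β = [])) : MemB X (relCyl X α β)
  | empty : MemB X ∅
  | union (A B : Set (Stream' 𝒜)) : MemB X A → MemB X B → MemB X (A ∪ B)
  | inter (A B : Set (Stream' 𝒜)) : MemB X A → MemB X B → MemB X (A ∩ B)
  | diff (A B : Set (Stream' 𝒜)) : MemB X A → MemB X B → MemB X (A \ B)

/-! ### The subshift algebra -/

/-- The generators `p_A`, `s_a`, `s_a^*` of the subshift algebra. -/
inductive SubshiftGen {𝒜 : Type*} (X : Set (Stream' 𝒜)) : Type _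
  | p (A : Set (Stream' 𝒜)) (hA : MemB X A) : SubshiftGen X
  | s (a : 𝒜) : SubshiftGen X
  | sStar (a : 𝒜) : SubshiftGen X

/-- The product `f a₁ * ⋯ * f aₙ` over a non-empty word (the value at the empty word is never
used). -/
def wordProd {𝒜 S : Type*} [Mul S] [Zero S] (f : 𝒜 → S) : List 𝒜 → S
  | [] => 0
  | [a] => f a
  | a :: b :: l => f a * wordProd f (b :: l)

namespace SubshiftAlg

variable (R : Type*) [CommRing R] {𝒜 : Type*} (X : Set (Stream' 𝒜))

/-- `p_A` in the free algebra. -/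
noncomputable def P (A : Set (Stream' 𝒜)) (hA : MemB X A) : FreeNonUnitalAlg R (SubshiftGen X) :=
  FreeNonUnitalAlg.of R (SubshiftGen.p A hA)

/-- `s_a` in the free algebra. -/
noncomputable def s (a : 𝒜) : FreeNonUnitalAlg R (SubshiftGen X) :=
  FreeNonUnitalAlg.of R (SubshiftGen.s a)

/-- `s_a^*` in the free algebra. -/
noncomputable def sStar (a : 𝒜) : FreeNonUnitalAlg R (SubshiftGen X) :=
  FreeNonUnitalAlg.of R (SubshiftGen.sStar a)

/-- `s_α = s_{α₁} ⋯ s_{αₙ}` for a non-empty word `α`. -/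
noncomputable def sWord (α : List 𝒜) : FreeNonUnitalAlg R (SubshiftGen X) :=
  wordProd (s R X) α

/-- `s_α^* = s_{αₙ}^* ⋯ s_{α₁}^*` for a non-empty word `α`. -/
noncomputable def sStarWord (α : List 𝒜) : FreeNonUnitalAlg R (SubshiftGen X) :=
  wordProd (sStar R X) α.reverse

/-- The defining relations of the subshift algebra. -/
inductive Rel : FreeNonUnitalAlg R (SubshiftGen X) → FreeNonUnitalAlg R (SubshiftGen X) → Prop
  | p_inter (A B : Set (Stream' 𝒜)) (hA : MemB X A) (hB : MemB X B) :
      Rel (P R X (A ∩ B) (MemB.inter A B hA hB)) (P R X A hA * P R X B hB)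
  | p_union (A B : Set (Stream' 𝒜)) (hA : MemB X A) (hB : MemB X B) :
      Rel (P R X (A ∪ B) (MemB.union A B hA hB))
        (P R X A hA + P R X B hB - P R X (A ∩ B) (MemB.inter A B hA hB))
  | p_empty : Rel (P R X ∅ MemB.empty) 0
  | s_sStar_s (a : 𝒜) : Rel (s R X a * sStar R X a * s R X a) (s R X a)
  | sStar_s_sStar (a : 𝒜) : Rel (sStar R X a * s R X a * sStar R X a) (sStar R X a)
  | p_relCyl (α β : List 𝒜) (hα : α ∈ language X) (hβ : β ∈ language X)
      (hα' : α ≠ []) (hβ' : β ≠ []) :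
      Rel (sWord R X β * sStarWord R X α * sWord R X α * sStarWord R X β)
        (P R X (relCyl X α β) (MemB.relCyl α β hα hβ fun h => hα' h.1))
  | p_follower (α : List 𝒜) (hα : α ∈ language X) (h0 : [] ∈ language X) (hα' : α ≠ []) :
      Rel (sStarWord R X α * sWord R X α)
        (P R X (relCyl X α []) (MemB.relCyl α [] hα h0 fun h => hα' h.1))
  | p_cylinder (β : List 𝒜) (hβ : β ∈ language X) (h0 : [] ∈ language X) (hβ' : β ≠ []) :
      Rel (sWord R X β * sStarWord R X β)
        (P R X (relCyl X [] β) (MemB.relCyl [] β h0 hβ fun h => hβ' h.2))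

end SubshiftAlg

/-- The (possibly non-unital) subshift algebra of `X` with coefficients in `R`. -/
abbrev SubshiftAlg (R : Type*) [CommRing R] {𝒜 : Type*} (X : Set (Stream' 𝒜)) : Type _ :=
  UniversalAlg (SubshiftAlg.Rel R X)

/-! ### Directed graphs, Leavitt path algebras and edge subshifts -/

/-- A directed graph with vertex set `V` and edge set `E`. -/
structure DirGraph (V E : Type*) where
  /-- the source of an edge -/
  src : E → V
  /-- the range of an edge -/
  rng : E → V

namespace DirGraph

variable {V E : Type*} (𝓔 : DirGraph V E)

/-- A sink emits no edge. -/
def IsSink (v : V) : Prop := ∀ e, 𝓔.src e ≠ v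

/-- A source receives no edge. -/
def IsSource (v : V) : Prop := ∀ e, 𝓔.rng e ≠ v

/-- An infinite emitter emits infinitely many edges. -/
def IsInfiniteEmitter (v : V) : Prop := {e | 𝓔.src e = v}.Infinite

/-- The one-sided edge subshift, with forbidden words `e f` such that `r(e) ≠ s(f)`. -/
def edgeSubshift : Set (Stream' E) :=
  subshift {w | ∃ e f : E, w = [e, f] ∧ 𝓔.rng e ≠ 𝓔.src f}

end DirGraph

/-- The generators `v`, `e`, `e^*` of the Leavitt path algebra. -/
inductive LeavittGen (V E : Type*) : Type _
  | vertex (v : V) : LeavittGen V E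
  | edge (e : E) : LeavittGen V E
  | ghost (e : E) : LeavittGen V E

namespace LeavittPathAlg

variable (R : Type*) [CommRing R] {V E : Type*}

/-- The vertex `v` in the free algebra. -/
noncomputable def vx (v : V) : FreeNonUnitalAlg R (LeavittGen V E) :=
  FreeNonUnitalAlg.of R (LeavittGen.vertex v)

/-- The edge `e` in the free algebra. -/
noncomputable def ed (e : E) : FreeNonUnitalAlg R (LeavittGen V E) :=
  FreeNonUnitalAlg.of R (LeavittGen.edge e)

/-- The ghost edge `e^*` in the free algebra. -/
noncomputable def gh (e : E) : FreeNonUnitalAlg R (LeavittGen V E) :=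
  FreeNonUnitalAlg.of R (LeavittGen.ghost e)

/-- The defining relations (V), (E1), (E2), (CK1), (CK2) of the Leavitt path algebra. -/
inductive Rel (𝓔 : DirGraph V E) :
    FreeNonUnitalAlg R (LeavittGen V E) → FreeNonUnitalAlg R (LeavittGen V E) → Prop
  | v_same (v : V) : Rel 𝓔 (vx R v * vx R v) (vx R v)
  | v_ne (v v' : V) (h : v ≠ v') : Rel 𝓔 (vx R v * vx R v') 0
  | src_mul_edge (e : E) : Rel 𝓔 (vx R (𝓔.src e) * ed R e) (ed R e)
  | edge_mul_rng (e : E) : Rel 𝓔 (ed R e * vx R (𝓔.rng e)) (ed R e)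
  | rng_mul_ghost (e : E) : Rel 𝓔 (vx R (𝓔.rng e) * gh R e) (gh R e)
  | ghost_mul_src (e : E) : Rel 𝓔 (gh R e * vx R (𝓔.src e)) (gh R e)
  | ck1_same (e : E) : Rel 𝓔 (gh R e * ed R e) (vx R (𝓔.rng e))
  | ck1_ne (e e' : E) (h : e ≠ e') : Rel 𝓔 (gh R e * ed R e') 0
  | ck2 (v : V) (hne : {e | 𝓔.src e = v}.Nonempty) (hfin : {e | 𝓔.src e = v}.Finite) :
      Rel 𝓔 (vx R v) (∑ e ∈ hfin.toFinset, ed R e * gh R e)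

end LeavittPathAlg

/-- The Leavitt path algebra of a directed graph with coefficients in `R`. -/
abbrev LeavittPathAlg (R : Type*) [CommRing R] {V E : Type*} (𝓔 : DirGraph V E) : Type _ :=
  UniversalAlg (LeavittPathAlg.Rel R 𝓔)

/-! In both algebras, `e e^*` stands for the infinite paths with first edge `e`, and `e^* e` for the
set `X_v` of infinite paths starting at `v = r(e)`. So `s_e` should correspond to `e` and `s_e^*` to
`e^*`; what needs proof is that `p_A` and `v` have consistent images.

Towards the Leavitt path algebra, `p_A` must go to a diagonal element (a combination of vertices and
products `α α^*`) whose function on infinite paths is the indicator of `A`. The crux is that a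
diagonal element is determined by its function: `eq_zero_of_mem_diagLevel`. No map from the diagonal
to functions is constructed. Pairs (function, element) are generated together, filtered by path
length, and induction on the length shows that a zero function forces a zero element. Evaluating at
paths `e x` peels off one level. At a finite emitter (CK2) gives the cancellation; at an infinite
emitter an edge outside the finite sum kills the vertex coefficient. The absence of sinks supplies
the paths at which to evaluate.

In the other direction `v` goes to `p_{X_v}`, which needs `X_v` in the Boolean algebra
(`memB_pathsFrom`). If `v = r(e)`, then `X_v = C(e, ω)`; if `v` is a source, it emits finitely many
edges and `X_v` is a finite union of cylinders.

Both composites fix edges and ghost edges. The `p_A` are fixed because they are polynomials in the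
`s_a` and `s_a^*` (`hom_proj_eq`), the vertices because representatives are unique
(`Represents.unique`). -/

namespace DirGraph

variable {V E : Type*} (𝓔 : DirGraph V E)

/-! ### Infinite paths and the sets `C(α, β)` of an edge subshift. -/

theorem take_two_drop (x : Stream' E) (n : ℕ) :
    (x.drop n).take 2 = [x.get n, x.get (n + 1)] := by
  rw [Stream'.take_succ, Stream'.take_succ, Stream'.take_zero, Stream'.head_drop,
    Stream'.tail_drop, Stream'.head_drop, ← Stream'.get_succ]

theorem mem_edgeSubshift_iff {x : Stream' E} :
    x ∈ 𝓔.edgeSubshift ↔ ∀ n, 𝓔.rng (x.get n) = 𝓔.src (x.get (n + 1)) := by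
  constructor
  · intro hx n
    by_contra h
    exact hx n 2 ⟨x.get n, x.get (n + 1), take_two_drop x n, h⟩
  · rintro hx m n ⟨e, f, hw, h⟩
    have hn : n = 2 := by simpa using congrArg List.length hw
    subst hn
    rw [take_two_drop] at hw
    simp only [List.cons.injEq, and_true] at hw
    exact h (hw.1 ▸ hw.2 ▸ hx m)

theorem cons_mem_edgeSubshift_iff {e : E} {x : Stream' E} :
    Stream'.cons e x ∈ 𝓔.edgeSubshift ↔ 𝓔.rng e = 𝓔.src x.head ∧ x ∈ 𝓔.edgeSubshift := by
  simp only [mem_edgeSubshift_iff]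
  constructor
  · exact fun h => ⟨h 0, fun n => h (n + 1)⟩
  · rintro ⟨h0, h⟩ (_ | n)
    exacts [h0, h n]

theorem tail_mem_edgeSubshift {x : Stream' E} (hx : x ∈ 𝓔.edgeSubshift) :
    x.tail ∈ 𝓔.edgeSubshift := by
  rw [← Stream'.eta x, cons_mem_edgeSubshift_iff] at hx
  exact hx.2

theorem src_head_tail {x : Stream' E} (hx : x ∈ 𝓔.edgeSubshift) :
    𝓔.src x.tail.head = 𝓔.rng x.head := by
  rw [← Stream'.eta x, cons_mem_edgeSubshift_iff] at hx
  exact hx.1.symm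

/-- The infinite paths that start at `v`. -/
def pathsFrom (v : V) : Set (Stream' E) := {x | x ∈ 𝓔.edgeSubshift ∧ 𝓔.src x.head = v}

theorem cons_mem_edgeSubshift {e : E} {x : Stream' E} (hx : x ∈ 𝓔.pathsFrom (𝓔.rng e)) :
    Stream'.cons e x ∈ 𝓔.edgeSubshift :=
  𝓔.cons_mem_edgeSubshift_iff.2 ⟨hx.2.symm, hx.1⟩

/-- Fixing an outgoing edge at every vertex prolongs any path for ever. These paths are the test
points at which coefficients are read off later. -/
theorem pathsFrom_nonempty (hsink : ∀ v, ¬ 𝓔.IsSink v) (v : V) : (𝓔.pathsFrom v).Nonempty := by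
  have h : ∀ v, ∃ e, 𝓔.src e = v := by simpa [IsSink] using hsink
  choose f hf using h
  refine ⟨Stream'.iterate (fun e => f (𝓔.rng e)) (f v), ?_, hf v⟩
  rw [mem_edgeSubshift_iff]
  intro n
  rw [Stream'.get_succ_iterate', hf]

theorem isChain_of_mem_language {α : List E} (hα : α ∈ language 𝓔.edgeSubshift) :
    α.IsChain fun e f => 𝓔.rng e = 𝓔.src f := by
  obtain ⟨x, hx, n, rfl⟩ := hα
  induction n generalizing x with
  | zero => simp
  | succ n ih =>
    have h := ih _ (𝓔.tail_mem_edgeSubshift hx)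
    cases n with
    | zero => simp [Stream'.take_succ]
    | succ n =>
      rw [Stream'.take_succ, Stream'.take_succ, List.isChain_cons_cons, ← Stream'.take_succ]
      exact ⟨(𝓔.src_head_tail hx).symm, h⟩

theorem relCyl_cons_nil {e : E} : relCyl 𝓔.edgeSubshift [e] [] = 𝓔.pathsFrom (𝓔.rng e) := by
  ext y
  constructor
  · rintro ⟨x, rfl, -, h⟩
    obtain ⟨h1, h2⟩ := 𝓔.cons_mem_edgeSubshift_iff.1 h
    exact ⟨h2, h1.symm⟩
  · rintro hy
    exact ⟨y, rfl, hy.1, 𝓔.cons_mem_edgeSubshift hy⟩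

/-- Admissibility only constrains consecutive edges, so an admissible first edge adds no condition:
what may follow a path depends on its last edge alone. -/
theorem relCyl_cons_cons_nil {e f : E} {α : List E} (h : 𝓔.rng e = 𝓔.src f) (β : List E) :
    relCyl 𝓔.edgeSubshift (e :: f :: α) β = relCyl 𝓔.edgeSubshift (f :: α) β := by
  have h1 : ∀ x, (e :: f :: α) ++ₛ x ∈ 𝓔.edgeSubshift ↔ (f :: α) ++ₛ x ∈ 𝓔.edgeSubshift := fun x =>
    𝓔.cons_mem_edgeSubshift_iff.trans (and_iff_right h)
  simp only [relCyl, h1]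

theorem mem_relCyl_cons {e : E} {α β : List E} {y : Stream' E} :
    y ∈ relCyl 𝓔.edgeSubshift α (e :: β) ↔
      y ∈ 𝓔.edgeSubshift ∧ y.head = e ∧ y.tail ∈ relCyl 𝓔.edgeSubshift α β := by
  constructor
  · rintro ⟨x, rfl, h, h'⟩
    exact ⟨h, rfl, x, rfl, 𝓔.tail_mem_edgeSubshift h, h'⟩
  · rintro ⟨h, rfl, x, hx, h', h''⟩
    have hy : y = (y.head :: β) ++ₛ x := by
      rw [Stream'.cons_append_stream, ← hx, Stream'.eta]
    exact ⟨x, hy, hy ▸ h, h''⟩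

theorem relCyl_nil_nil : relCyl 𝓔.edgeSubshift [] [] = 𝓔.edgeSubshift := by
  ext y
  constructor
  · rintro ⟨x, rfl, h, -⟩
    exact h
  · exact fun h => ⟨y, rfl, h, h⟩

theorem mem_relCyl_nil_singleton {e : E} {y : Stream' E} :
    y ∈ relCyl 𝓔.edgeSubshift [] [e] ↔ y ∈ 𝓔.edgeSubshift ∧ y.head = e := by
  rw [mem_relCyl_cons, relCyl_nil_nil]
  exact ⟨fun h => ⟨h.1, h.2.1⟩, fun h => ⟨h.1, h.2, 𝓔.tail_mem_edgeSubshift h.1⟩⟩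

end DirGraph

/-! ### Functions on infinite paths paired with elements of the Leavitt path algebra. -/

namespace LeavittPathAlg

variable (R : Type*) [CommRing R] {V E : Type*} (𝓔 : DirGraph V E)

/-- The vertex `v` in the Leavitt path algebra. -/
noncomputable def vertex (v : V) : LeavittPathAlg R 𝓔 :=
  UniversalAlg.gen (Rel R 𝓔) (LeavittGen.vertex v)

/-- The edge `e` in the Leavitt path algebra. -/
noncomputable def edge (e : E) : LeavittPathAlg R 𝓔 :=
  UniversalAlg.gen (Rel R 𝓔) (LeavittGen.edge e)

/-- The ghost edge `e^*` in the Leavitt path algebra. -/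
noncomputable def ghost (e : E) : LeavittPathAlg R 𝓔 :=
  UniversalAlg.gen (Rel R 𝓔) (LeavittGen.ghost e)

theorem mk_vx (v : V) : UniversalAlg.mk (Rel R 𝓔) (vx R v) = vertex R 𝓔 v := rfl

theorem mk_ed (e : E) : UniversalAlg.mk (Rel R 𝓔) (ed R e) = edge R 𝓔 e := rfl

theorem mk_gh (e : E) : UniversalAlg.mk (Rel R 𝓔) (gh R e) = ghost R 𝓔 e := rfl

theorem vertex_mul_self (v : V) : vertex R 𝓔 v * vertex R 𝓔 v = vertex R 𝓔 v := by
  simpa only [mk_vx, mk_ed, mk_gh, map_mul] using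
    UniversalAlg.mk_eq_of_rel _ (Rel.v_same (R := R) (𝓔 := 𝓔) v)

theorem vertex_mul_of_ne {v v' : V} (h : v ≠ v') : vertex R 𝓔 v * vertex R 𝓔 v' = 0 := by
  simpa only [mk_vx, mk_ed, mk_gh, map_mul, map_zero] using
    UniversalAlg.mk_eq_of_rel _ (Rel.v_ne (R := R) (𝓔 := 𝓔) v v' h)

theorem src_mul_edge (e : E) : vertex R 𝓔 (𝓔.src e) * edge R 𝓔 e = edge R 𝓔 e := by
  simpa only [mk_vx, mk_ed, mk_gh, map_mul] using
    UniversalAlg.mk_eq_of_rel _ (Rel.src_mul_edge (R := R) (𝓔 := 𝓔) e)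

theorem edge_mul_rng (e : E) : edge R 𝓔 e * vertex R 𝓔 (𝓔.rng e) = edge R 𝓔 e := by
  simpa only [mk_vx, mk_ed, mk_gh, map_mul] using
    UniversalAlg.mk_eq_of_rel _ (Rel.edge_mul_rng (R := R) (𝓔 := 𝓔) e)

theorem rng_mul_ghost (e : E) : vertex R 𝓔 (𝓔.rng e) * ghost R 𝓔 e = ghost R 𝓔 e := by
  simpa only [mk_vx, mk_ed, mk_gh, map_mul] using
    UniversalAlg.mk_eq_of_rel _ (Rel.rng_mul_ghost (R := R) (𝓔 := 𝓔) e)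

theorem ghost_mul_src (e : E) : ghost R 𝓔 e * vertex R 𝓔 (𝓔.src e) = ghost R 𝓔 e := by
  simpa only [mk_vx, mk_ed, mk_gh, map_mul] using
    UniversalAlg.mk_eq_of_rel _ (Rel.ghost_mul_src (R := R) (𝓔 := 𝓔) e)

theorem ghost_mul_edge (e : E) : ghost R 𝓔 e * edge R 𝓔 e = vertex R 𝓔 (𝓔.rng e) := by
  simpa only [mk_vx, mk_ed, mk_gh, map_mul] using
    UniversalAlg.mk_eq_of_rel _ (Rel.ck1_same (R := R) (𝓔 := 𝓔) e)

theorem ghost_mul_edge_of_ne {e f : E} (h : e ≠ f) : ghost R 𝓔 e * edge R 𝓔 f = 0 := by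
  simpa only [mk_vx, mk_ed, mk_gh, map_mul, map_zero] using
    UniversalAlg.mk_eq_of_rel _ (Rel.ck1_ne (R := R) (𝓔 := 𝓔) e f h)

theorem vertex_eq_sum (v : V) (hne : {e | 𝓔.src e = v}.Nonempty)
    (hfin : {e | 𝓔.src e = v}.Finite) :
    vertex R 𝓔 v = ∑ e ∈ hfin.toFinset, edge R 𝓔 e * ghost R 𝓔 e := by
  simpa only [mk_vx, mk_ed, mk_gh, map_mul, map_sum] using
    UniversalAlg.mk_eq_of_rel _ (Rel.ck2 (R := R) (𝓔 := 𝓔) v hne hfin)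

open scoped Classical in
/-- The weighting `f ↦ (e x ↦ f x)` of functions on infinite paths by an edge `e`. -/
noncomputable def shiftFun (e : E) : (Stream' E → R) →ₗ[R] (Stream' E → R) where
  toFun f y := if y ∈ 𝓔.edgeSubshift ∧ y.head = e then f y.tail else 0
  map_add' f g := by
    ext y
    simp only [Pi.add_apply]
    split_ifs <;> simp
  map_smul' c f := by
    ext y
    simp

open scoped Classical in
theorem shiftFun_apply (e : E) (f : Stream' E → R) (y : Stream' E) :
    shiftFun R 𝓔 e f y = if y ∈ 𝓔.edgeSubshift ∧ y.head = e then f y.tail else 0 := rfl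

/-- Pairs of a function on infinite paths and an element of the Leavitt path algebra. -/
abbrev Pair : Type _ := (Stream' E → R) × LeavittPathAlg R 𝓔

/-- The pair `(1_{X_v}, v)`. -/
noncomputable def vertexPair (v : V) : Pair R 𝓔 :=
  ((𝓔.pathsFrom v).indicator 1, vertex R 𝓔 v)

/-- The map `(f, d) ↦ (e x ↦ f x, e d e^*)`. -/
noncomputable def corner (e : E) : Pair R 𝓔 →ₗ[R] Pair R 𝓔 :=
  (shiftFun R 𝓔 e).prodMap
    ((LinearMap.mulLeft R (edge R 𝓔 e)).comp (LinearMap.mulRight R (ghost R 𝓔 e)))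

variable {R 𝓔}

@[simp] theorem corner_fst (e : E) (t : Pair R 𝓔) :
    (corner R 𝓔 e t).1 = shiftFun R 𝓔 e t.1 := rfl

@[simp] theorem corner_snd (e : E) (t : Pair R 𝓔) :
    (corner R 𝓔 e t).2 = edge R 𝓔 e * (t.2 * ghost R 𝓔 e) := rfl

theorem shiftFun_cons {e : E} (f : Stream' E → R) {x : Stream' E}
    (hx : x ∈ 𝓔.pathsFrom (𝓔.rng e)) : shiftFun R 𝓔 e f (Stream'.cons e x) = f x := by
  rw [shiftFun_apply, if_pos ⟨𝓔.cons_mem_edgeSubshift hx, rfl⟩, Stream'.tail_cons]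

theorem shiftFun_cons_of_ne {e e' : E} (h : e' ≠ e) (f : Stream' E → R) (x : Stream' E) :
    shiftFun R 𝓔 e f (Stream'.cons e' x) = 0 := by
  rw [shiftFun_apply, if_neg]
  exact fun h' => h h'.2

theorem vertexPair_mul_self (v : V) : vertexPair R 𝓔 v * vertexPair R 𝓔 v = vertexPair R 𝓔 v := by
  refine Prod.ext ?_ (vertex_mul_self R 𝓔 v)
  ext y
  by_cases hy : y ∈ 𝓔.pathsFrom v <;> simp [vertexPair, hy]

theorem vertexPair_mul_of_ne {v w : V} (h : v ≠ w) :
    vertexPair R 𝓔 v * vertexPair R 𝓔 w = 0 := by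
  refine Prod.ext ?_ (vertex_mul_of_ne R 𝓔 h)
  ext y
  by_cases hy : y ∈ 𝓔.pathsFrom v
  · have : y ∉ 𝓔.pathsFrom w := fun hy' => h (hy.2.symm.trans hy'.2)
    simp [vertexPair, this]
  · simp [vertexPair, hy]

theorem vertexPair_mul_corner (e : E) (t : Pair R 𝓔) :
    vertexPair R 𝓔 (𝓔.src e) * corner R 𝓔 e t = corner R 𝓔 e t := by
  refine Prod.ext ?_ ?_
  · ext y
    by_cases hy : y ∈ 𝓔.edgeSubshift ∧ y.head = e
    · have : y ∈ 𝓔.pathsFrom (𝓔.src e) := ⟨hy.1, by rw [hy.2]⟩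
      simp [vertexPair, this]
    · simp [shiftFun_apply, hy]
  · simp only [Prod.snd_mul, corner_snd, vertexPair]
    rw [← mul_assoc, src_mul_edge]

theorem corner_mul_vertexPair (e : E) (t : Pair R 𝓔) :
    corner R 𝓔 e t * vertexPair R 𝓔 (𝓔.src e) = corner R 𝓔 e t := by
  refine Prod.ext ?_ ?_
  · ext y
    by_cases hy : y ∈ 𝓔.edgeSubshift ∧ y.head = e
    · have : y ∈ 𝓔.pathsFrom (𝓔.src e) := ⟨hy.1, by rw [hy.2]⟩
      simp [vertexPair, this]
    · simp [shiftFun_apply, hy]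
  · simp only [Prod.snd_mul, corner_snd, vertexPair]
    rw [mul_assoc, mul_assoc, ghost_mul_src]

theorem vertexPair_mul_corner_of_ne {v : V} {e : E} (h : v ≠ 𝓔.src e) (t : Pair R 𝓔) :
    vertexPair R 𝓔 v * corner R 𝓔 e t = 0 := by
  rw [← vertexPair_mul_corner, ← mul_assoc, vertexPair_mul_of_ne h, zero_mul]

theorem corner_mul_vertexPair_of_ne {v : V} {e : E} (h : 𝓔.src e ≠ v) (t : Pair R 𝓔) :
    corner R 𝓔 e t * vertexPair R 𝓔 v = 0 := by
  rw [← corner_mul_vertexPair, mul_assoc, vertexPair_mul_of_ne h, mul_zero]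

/-- In the algebra `e^* e = r(e)` appears in the middle. On functions this factor is invisible,
since the tail of a path with first edge `e` starts at `r(e)`. -/
theorem corner_mul_corner (e : E) (t u : Pair R 𝓔) :
    corner R 𝓔 e t * corner R 𝓔 e u = corner R 𝓔 e (t * vertexPair R 𝓔 (𝓔.rng e) * u) := by
  refine Prod.ext ?_ ?_
  · ext y
    by_cases hy : y ∈ 𝓔.edgeSubshift ∧ y.head = e
    · have : y.tail ∈ 𝓔.pathsFrom (𝓔.rng e) :=
        ⟨𝓔.tail_mem_edgeSubshift hy.1, by rw [𝓔.src_head_tail hy.1, hy.2]⟩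
      simp [vertexPair, shiftFun_apply, hy, this]
    · simp [shiftFun_apply, hy]
  · simp only [Prod.snd_mul, corner_snd, vertexPair]
    rw [← ghost_mul_edge]
    simp only [mul_assoc]

theorem corner_mul_corner_of_ne {e f : E} (h : e ≠ f) (t u : Pair R 𝓔) :
    corner R 𝓔 e t * corner R 𝓔 f u = 0 := by
  refine Prod.ext ?_ ?_
  · ext y
    by_cases hy : y.head = e
    · subst hy
      simp [shiftFun_apply, h]
    · simp [shiftFun_apply, hy]
  · simp only [Prod.snd_mul, corner_snd]
    rw [mul_assoc, mul_assoc, ← mul_assoc (ghost R 𝓔 e), ghost_mul_edge_of_ne R 𝓔 h]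
    simp

theorem corner_vertexPair_mul (e : E) (t : Pair R 𝓔) :
    corner R 𝓔 e (vertexPair R 𝓔 (𝓔.rng e) * t) = corner R 𝓔 e t := by
  refine Prod.ext ?_ ?_
  · ext y
    by_cases hy : y ∈ 𝓔.edgeSubshift ∧ y.head = e
    · have : y.tail ∈ 𝓔.pathsFrom (𝓔.rng e) :=
        ⟨𝓔.tail_mem_edgeSubshift hy.1, by rw [𝓔.src_head_tail hy.1, hy.2]⟩
      simp [vertexPair, shiftFun_apply, hy, this]
    · simp [shiftFun_apply, hy]
  · simp only [Prod.snd_mul, corner_snd, vertexPair]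
    rw [mul_assoc, ← mul_assoc, edge_mul_rng]

/-- (CK2) in the algebra is matched on functions by the partition of the paths from `v` according to
their first edge. -/
theorem vertexPair_eq_sum (v : V) (hne : {e | 𝓔.src e = v}.Nonempty)
    (hfin : {e | 𝓔.src e = v}.Finite) :
    vertexPair R 𝓔 v = ∑ e ∈ hfin.toFinset, corner R 𝓔 e (vertexPair R 𝓔 (𝓔.rng e)) := by
  refine Prod.ext ?_ ?_
  · rw [Prod.fst_sum]
    ext y
    rw [Finset.sum_apply]
    by_cases hy : y ∈ 𝓔.pathsFrom v
    · have h1 : y.tail ∈ 𝓔.pathsFrom (𝓔.rng y.head) :=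
        ⟨𝓔.tail_mem_edgeSubshift hy.1, 𝓔.src_head_tail hy.1⟩
      rw [Finset.sum_eq_single y.head]
      · simp [vertexPair, shiftFun_apply, hy, hy.1, h1]
      · intro e _ he
        simp [shiftFun_apply, he.symm]
      · intro h
        exact absurd hy.2 (by simpa using h)
    · rw [Finset.sum_eq_zero]
      · simp [vertexPair, hy]
      · intro e he
        have he' : 𝓔.src e = v := by simpa using he
        rw [corner_fst, shiftFun_apply, if_neg]
        rintro ⟨h1, rfl⟩
        exact hy ⟨h1, he'⟩
  · rw [Prod.snd_sum]
    refine (vertex_eq_sum R 𝓔 v hne hfin).trans (Finset.sum_congr rfl fun e _ => ?_)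
    rw [corner_snd]
    simp only [vertexPair]
    rw [rng_mul_ghost]

end LeavittPathAlg

/-! ### The diagonal, filtered by path length, and its faithfulness on infinite paths. -/

namespace LeavittPathAlg

variable (R : Type*) [CommRing R] {V E : Type*} (𝓔 : DirGraph V E)

/-- The pairs `(f, d)` in which `d` is a combination of vertices and elements `α α^*` with `α` a
path of length at most `n`, and `f` is the function on infinite paths that `d` represents. -/
noncomputable def diagLevel : ℕ → Submodule R (Pair R 𝓔)
  | 0 => Submodule.span R (Set.range (vertexPair R 𝓔))
  | n + 1 => Submodule.span R (Set.range (vertexPair R 𝓔)) ⊔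
      ⨆ e, (diagLevel n).map (corner R 𝓔 e)

variable {R 𝓔}

theorem span_vertexPair_le_diagLevel (n : ℕ) :
    Submodule.span R (Set.range (vertexPair R 𝓔)) ≤ diagLevel R 𝓔 n := by
  cases n
  exacts [le_rfl, le_sup_left]

theorem vertexPair_mem_diagLevel (n : ℕ) (v : V) : vertexPair R 𝓔 v ∈ diagLevel R 𝓔 n :=
  span_vertexPair_le_diagLevel n (Submodule.subset_span ⟨v, rfl⟩)

theorem corner_mem_diagLevel {n : ℕ} {t : Pair R 𝓔} (ht : t ∈ diagLevel R 𝓔 n) (e : E) :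
    corner R 𝓔 e t ∈ diagLevel R 𝓔 (n + 1) :=
  Submodule.mem_sup_right (Submodule.mem_iSup_of_mem e (Submodule.mem_map_of_mem ht))

theorem diagLevel_le_succ (n : ℕ) : diagLevel R 𝓔 n ≤ diagLevel R 𝓔 (n + 1) := by
  induction n with
  | zero => exact span_vertexPair_le_diagLevel 1
  | succ n ih => exact sup_le_sup_left (iSup_mono fun e => Submodule.map_mono ih) _

theorem diagLevel_mono : Monotone (diagLevel R 𝓔) := monotone_nat_of_le_succ diagLevel_le_succ

/-- Induction principle for `diagLevel (n + 1)`. -/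
theorem diagLevel_succ_induction {n : ℕ} {p : Pair R 𝓔 → Prop}
    (vert : ∀ v, p (vertexPair R 𝓔 v))
    (corn : ∀ e, ∀ t ∈ diagLevel R 𝓔 n, p (corner R 𝓔 e t))
    (zero : p 0) (add : ∀ t u, p t → p u → p (t + u)) (smul : ∀ (c : R) t, p t → p (c • t))
    {t : Pair R 𝓔} (ht : t ∈ diagLevel R 𝓔 (n + 1)) : p t := by
  obtain ⟨a, ha, b, hb, rfl⟩ := Submodule.mem_sup.1 ht
  refine add _ _ ?_ ?_
  · refine Submodule.span_induction ?_ zero (fun _ _ _ _ => add _ _)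
      (fun c t _ => smul c t) ha
    rintro _ ⟨v, rfl⟩
    exact vert v
  · refine Submodule.iSup_induction _ (motive := p) hb ?_ zero add
    rintro e _ ⟨t, ht, rfl⟩
    exact corn e t ht

theorem vertexPair_mul_mem_diagLevel {n : ℕ} (v : V) {t : Pair R 𝓔}
    (ht : t ∈ diagLevel R 𝓔 n) : vertexPair R 𝓔 v * t ∈ diagLevel R 𝓔 n := by
  have hv : ∀ n w, vertexPair R 𝓔 v * vertexPair R 𝓔 w ∈ diagLevel R 𝓔 n := by
    intro n w
    by_cases h : v = w
    · subst h
      rw [vertexPair_mul_self]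
      exact vertexPair_mem_diagLevel n v
    · rw [vertexPair_mul_of_ne h]
      exact zero_mem _
  cases n with
  | zero =>
    refine Submodule.span_induction ?_ ?_ ?_ ?_ ht
    · rintro _ ⟨w, rfl⟩
      exact hv 0 w
    · simp
    · intro a b _ _ ha hb
      rw [mul_add]
      exact add_mem ha hb
    · intro c a _ ha
      rw [mul_smul_comm]
      exact Submodule.smul_mem _ c ha
  | succ n =>
    refine diagLevel_succ_induction
      (p := fun t => vertexPair R 𝓔 v * t ∈ diagLevel R 𝓔 (n + 1)) (hv _) ?_ ?_ ?_ ?_ ht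
    · intro e t ht
      by_cases h : v = 𝓔.src e
      · subst h
        rw [vertexPair_mul_corner]
        exact corner_mem_diagLevel ht e
      · rw [vertexPair_mul_corner_of_ne h]
        exact zero_mem _
    · simp
    · intro a b ha hb
      rw [mul_add]
      exact add_mem ha hb
    · intro c a ha
      rw [mul_smul_comm]
      exact Submodule.smul_mem _ c ha

theorem mul_mem_diagLevel {n : ℕ} {t u : Pair R 𝓔} (ht : t ∈ diagLevel R 𝓔 n)
    (hu : u ∈ diagLevel R 𝓔 n) : t * u ∈ diagLevel R 𝓔 n := by
  induction n generalizing t u with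
  | zero =>
    refine Submodule.span_induction ?_ ?_ ?_ ?_ ht
    · rintro _ ⟨v, rfl⟩
      exact vertexPair_mul_mem_diagLevel v hu
    · simp
    · intro a b _ _ ha hb
      rw [add_mul]
      exact add_mem ha hb
    · intro c a _ ha
      rw [smul_mul_assoc]
      exact Submodule.smul_mem _ c ha
  | succ n ih =>
    refine diagLevel_succ_induction (p := fun t => t * u ∈ diagLevel R 𝓔 (n + 1))
      (fun v => vertexPair_mul_mem_diagLevel v hu) ?_ ?_ ?_ ?_ ht
    · intro e t ht
      refine diagLevel_succ_induction
        (p := fun u => corner R 𝓔 e t * u ∈ diagLevel R 𝓔 (n + 1)) ?_ ?_ ?_ ?_ ?_ hu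
      · intro v
        by_cases h : 𝓔.src e = v
        · subst h
          rw [corner_mul_vertexPair]
          exact corner_mem_diagLevel ht e
        · rw [corner_mul_vertexPair_of_ne h]
          exact zero_mem _
      · intro f u hu
        by_cases h : e = f
        · subst h
          rw [corner_mul_corner]
          exact corner_mem_diagLevel (ih (ih ht (vertexPair_mem_diagLevel n _)) hu) e
        · rw [corner_mul_corner_of_ne h]
          exact zero_mem _
      · simp
      · intro a b ha hb
        rw [mul_add]
        exact add_mem ha hb
      · intro c a ha
        rw [mul_smul_comm]
        exact Submodule.smul_mem _ c ha
    · simp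
    · intro a b ha hb
      rw [add_mul]
      exact add_mem ha hb
    · intro c a ha
      rw [smul_mul_assoc]
      exact Submodule.smul_mem _ c ha

/-- Since `c` and `u` vanish off `W` and `F`, a single formula gives the value at `e x` for every
edge `e`, whether or not it occurs in the sums. -/
theorem exists_eq_sum_of_mem_diagLevel_succ {n : ℕ} {t : Pair R 𝓔}
    (ht : t ∈ diagLevel R 𝓔 (n + 1)) :
    ∃ (W : Finset V) (c : V → R) (F : Finset E) (u : E → Pair R 𝓔),
      (∀ v ∉ W, c v = 0) ∧ (∀ e ∉ F, u e = 0) ∧ (∀ e, u e ∈ diagLevel R 𝓔 n) ∧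
      t = ∑ v ∈ W, c v • vertexPair R 𝓔 v + ∑ e ∈ F, corner R 𝓔 e (u e) := by
  classical
  obtain ⟨a, ha, b, hb, rfl⟩ := Submodule.mem_sup.1 ht
  obtain ⟨c, rfl⟩ := Finsupp.mem_span_range_iff_exists_finsupp.1 ha
  obtain ⟨g, hg, rfl⟩ := (Submodule.mem_iSup_iff_exists_finsupp _ _).1 hb
  choose u hu hu' using fun e => Submodule.mem_map.1 (hg e)
  -- Off the support the chosen preimage of `0` under `corner` need not be `0`, hence the
  -- replacement.
  refine ⟨c.support, c, g.support, fun e => if e ∈ g.support then u e else 0,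
    fun v => Finsupp.notMem_support_iff.1, fun e he => if_neg he, fun e => ?_, ?_⟩
  · dsimp only
    split_ifs
    exacts [hu e, zero_mem _]
  · rw [Finsupp.sum, Finsupp.sum]
    congr 1
    refine Finset.sum_congr rfl fun e he => ?_
    dsimp only
    rw [if_pos he, hu']

/-- The function determines the element of the Leavitt path algebra. -/
theorem eq_zero_of_mem_diagLevel (hsink : ∀ v, ¬ 𝓔.IsSink v) {n : ℕ} {t : Pair R 𝓔}
    (ht : t ∈ diagLevel R 𝓔 n) (h0 : t.1 = 0) : t = 0 := by
  classical
  induction n generalizing t with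
  | zero =>
    obtain ⟨c, rfl⟩ := Finsupp.mem_span_range_iff_exists_finsupp.1 ht
    refine Finset.sum_eq_zero fun v _ => ?_
    -- The sets of paths from different vertices are disjoint, so a path from `v` isolates the
    -- coefficient of `v`.
    obtain ⟨x, hx⟩ := 𝓔.pathsFrom_nonempty hsink v
    have h : (c.sum fun w a => a • vertexPair R 𝓔 w).1 x = c v := by
      rw [Finsupp.sum, Prod.fst_sum, Finset.sum_apply, Finset.sum_eq_single v]
      · simp [vertexPair, hx]
      · intro w _ hw
        have : x ∉ 𝓔.pathsFrom w := fun hx' => hw (hx'.2.symm.trans hx.2)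
        simp [vertexPair, this]
      · intro hv
        simp [Finsupp.notMem_support_iff.1 hv]
    rw [h0] at h
    rw [← h]
    exact zero_smul _ _
  | succ n ih =>
    obtain ⟨W, c, F, u, hW, hF, hu, htsum⟩ := exists_eq_sum_of_mem_diagLevel_succ ht
    -- At `e x` only the vertex `s(e)` and the corner of `e` contribute.
    have hval : ∀ e, ∀ x ∈ 𝓔.pathsFrom (𝓔.rng e), c (𝓔.src e) + (u e).1 x = 0 := by
      intro e x hx
      have h : t.1 (Stream'.cons e x) = c (𝓔.src e) + (u e).1 x := by
        have hmem := 𝓔.cons_mem_edgeSubshift hx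
        rw [htsum, Prod.fst_add, Pi.add_apply, Prod.fst_sum, Prod.fst_sum, Finset.sum_apply,
          Finset.sum_apply, Finset.sum_eq_single (𝓔.src e), Finset.sum_eq_single e]
        · have : Stream'.cons e x ∈ 𝓔.pathsFrom (𝓔.src e) := ⟨hmem, rfl⟩
          rw [corner_fst, shiftFun_cons _ hx]
          simp [vertexPair, this]
        · intro f _ hf
          rw [corner_fst, shiftFun_cons_of_ne hf.symm]
        · intro he
          simp [hF e he]
        · intro w _ hw
          have : Stream'.cons e x ∉ 𝓔.pathsFrom w := fun hx' => hw hx'.2.symm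
          simp [vertexPair, this]
        · intro he
          simp [hW _ he]
      rw [← h, h0]
      rfl
    have hcorner : ∀ e, c (𝓔.src e) • corner R 𝓔 e (vertexPair R 𝓔 (𝓔.rng e)) +
        corner R 𝓔 e (u e) = 0 := by
      intro e
      -- `hval` controls the function only on paths from `r(e)`. Multiplying by `r(e)` discards the
      -- rest, so the induction hypothesis applies, and `corner` absorbs the extra factor.
      have h : vertexPair R 𝓔 (𝓔.rng e) * (c (𝓔.src e) • vertexPair R 𝓔 (𝓔.rng e) + u e) = 0 := by
        refine ih (vertexPair_mul_mem_diagLevel _ (add_mem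
          (Submodule.smul_mem _ _ (vertexPair_mem_diagLevel n _)) (hu e))) ?_
        ext x
        by_cases hx : x ∈ 𝓔.pathsFrom (𝓔.rng e)
        · simpa [vertexPair, hx] using hval e x hx
        · simp [vertexPair, hx]
      rw [← map_smul, ← map_add, ← corner_vertexPair_mul, h, map_zero]
    have hvert : ∀ v, c v • vertexPair R 𝓔 v +
        ∑ e ∈ F with 𝓔.src e = v, corner R 𝓔 e (u e) = 0 := by
      intro v
      -- At a finite emitter (CK2) spreads `c v • v` over the edges leaving `v`, where `hcorner`
      -- cancels it term by term. At an infinite emitter some edge lies outside `F`; there `u e =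
      -- 0`, so `hval` gives `c v = 0`.
      by_cases hfin : {e | 𝓔.src e = v}.Finite
      · have hne : {e | 𝓔.src e = v}.Nonempty := by
          by_contra hne
          exact hsink v fun e he => hne ⟨e, he⟩
        have hsum : ∑ e ∈ F with 𝓔.src e = v, corner R 𝓔 e (u e) =
            ∑ e ∈ hfin.toFinset, corner R 𝓔 e (u e) := by
          refine Finset.sum_subset (fun e he => by simpa using (Finset.mem_filter.1 he).2) ?_
          intro e he he'
          have : e ∉ F := fun heF => he' (Finset.mem_filter.2 ⟨heF, by simpa using he⟩)
          rw [hF e this, map_zero]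
        rw [hsum, vertexPair_eq_sum v hne hfin, Finset.smul_sum, ← Finset.sum_add_distrib]
        refine Finset.sum_eq_zero fun e he => ?_
        have he' : 𝓔.src e = v := by simpa using he
        rw [← he']
        exact hcorner e
      · obtain ⟨e, he, heF⟩ := Set.Infinite.exists_notMem_finset hfin F
        have he' : 𝓔.src e = v := he
        obtain ⟨x, hx⟩ := 𝓔.pathsFrom_nonempty hsink (𝓔.rng e)
        have hc : c v = 0 := by simpa [hF e heF, he'] using hval e x hx
        rw [hc, zero_smul, zero_add]
        refine Finset.sum_eq_zero fun f hf => ?_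
        have hf' : 𝓔.src f = v := (Finset.mem_filter.1 hf).2
        simpa [hf', hc] using hcorner f
    -- Adding the sources of the edges in `F` to the index set lets both sums be grouped by vertex.
    have hW' : ∑ v ∈ W, c v • vertexPair R 𝓔 v =
        ∑ v ∈ W ∪ F.image 𝓔.src, c v • vertexPair R 𝓔 v :=
      Finset.sum_subset Finset.subset_union_left fun v _ hv => by rw [hW v hv, zero_smul]
    rw [htsum, hW', ← Finset.sum_fiberwise_of_maps_to (s := F) (t := W ∪ F.image 𝓔.src)
      (g := 𝓔.src) (fun e he => Finset.mem_union_right _ (Finset.mem_image_of_mem _ he)),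
      ← Finset.sum_add_distrib]
    exact Finset.sum_eq_zero fun v _ => hvert v

/-! ### Sets of infinite paths represented by diagonal elements. -/

variable (R 𝓔) in
/-- `d` represents the set `A` of infinite paths. -/
def Represents (A : Set (Stream' E)) (d : LeavittPathAlg R 𝓔) : Prop :=
  ∃ n, (A.indicator 1, d) ∈ diagLevel R 𝓔 n

/-- At a common level the two pairs differ by a pair with zero function. Every relation involving
some `p_A` is checked in the Leavitt path algebra through this. -/
theorem Represents.unique (hsink : ∀ v, ¬ 𝓔.IsSink v) {A : Set (Stream' E)}
    {d d' : LeavittPathAlg R 𝓔} (h : Represents R 𝓔 A d) (h' : Represents R 𝓔 A d') : d = d' := by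
  obtain ⟨n, hn⟩ := h
  obtain ⟨m, hm⟩ := h'
  have key := eq_zero_of_mem_diagLevel hsink (sub_mem (diagLevel_mono (le_max_left n m) hn)
    (diagLevel_mono (le_max_right n m) hm)) (sub_self _)
  exact sub_eq_zero.1 (congrArg Prod.snd key)

theorem Represents.vertex (v : V) : Represents R 𝓔 (𝓔.pathsFrom v) (vertex R 𝓔 v) :=
  ⟨0, vertexPair_mem_diagLevel 0 v⟩

theorem Represents.empty : Represents R 𝓔 ∅ 0 :=
  ⟨0, by rw [Set.indicator_empty]; exact zero_mem _⟩

theorem Represents.inter {A B : Set (Stream' E)} {d d' : LeavittPathAlg R 𝓔}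
    (h : Represents R 𝓔 A d) (h' : Represents R 𝓔 B d') : Represents R 𝓔 (A ∩ B) (d * d') := by
  obtain ⟨n, hn⟩ := h
  obtain ⟨m, hm⟩ := h'
  refine ⟨max n m, ?_⟩
  rw [Set.inter_indicator_one]
  exact mul_mem_diagLevel (diagLevel_mono (le_max_left n m) hn)
    (diagLevel_mono (le_max_right n m) hm)

theorem Represents.diff {A B : Set (Stream' E)} {d d' : LeavittPathAlg R 𝓔}
    (h : Represents R 𝓔 A d) (h' : Represents R 𝓔 B d') :
    Represents R 𝓔 (A \ B) (d - d * d') := by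
  have hi := h.inter h'
  obtain ⟨n, hn⟩ := h
  obtain ⟨m, hm⟩ := hi
  refine ⟨max n m, ?_⟩
  have hf : (A \ B).indicator (1 : Stream' E → R) =
      A.indicator 1 - (A ∩ B).indicator 1 := by
    ext x
    by_cases hA : x ∈ A <;> by_cases hB : x ∈ B <;> simp [hA, hB]
  rw [hf]
  exact sub_mem (diagLevel_mono (le_max_left n m) hn) (diagLevel_mono (le_max_right n m) hm)

theorem Represents.union {A B : Set (Stream' E)} {d d' : LeavittPathAlg R 𝓔}
    (h : Represents R 𝓔 A d) (h' : Represents R 𝓔 B d') :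
    Represents R 𝓔 (A ∪ B) (d + d' - d * d') := by
  have hi := h.inter h'
  obtain ⟨n, hn⟩ := h
  obtain ⟨m, hm⟩ := h'
  obtain ⟨k, hk⟩ := hi
  refine ⟨max (max n m) k, ?_⟩
  have hf : (A ∪ B).indicator (1 : Stream' E → R) =
      A.indicator 1 + B.indicator 1 - (A ∩ B).indicator 1 := by
    ext x
    by_cases hA : x ∈ A <;> by_cases hB : x ∈ B <;> simp [hA, hB]
  rw [hf]
  exact sub_mem (add_mem
    (diagLevel_mono ((le_max_left n m).trans (le_max_left _ k)) hn)
    (diagLevel_mono ((le_max_right n m).trans (le_max_left _ k)) hm))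
    (diagLevel_mono (le_max_right _ k) hk)

/-- Prefixing `β` by `e` acts on the indicator function exactly as `corner` does, at the cost of one
level. -/
theorem Represents.relCyl_cons {α β : List E} {d : LeavittPathAlg R 𝓔}
    (h : Represents R 𝓔 (relCyl 𝓔.edgeSubshift α β) d) (e : E) :
    Represents R 𝓔 (relCyl 𝓔.edgeSubshift α (e :: β)) (edge R 𝓔 e * (d * ghost R 𝓔 e)) := by
  obtain ⟨n, hn⟩ := h
  refine ⟨n + 1, ?_⟩
  convert corner_mem_diagLevel hn e using 1
  refine Prod.ext ?_ rfl
  ext y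
  rw [corner_fst, shiftFun_apply]
  dsimp only
  by_cases hy : y ∈ 𝓔.edgeSubshift ∧ y.head = e
  · by_cases hy' : y.tail ∈ relCyl 𝓔.edgeSubshift α β <;>
      simp [Set.indicator, 𝓔.mem_relCyl_cons, hy, hy']
  · rw [if_neg hy, Set.indicator_of_notMem]
    exact fun h => hy ⟨(𝓔.mem_relCyl_cons.1 h).1, (𝓔.mem_relCyl_cons.1 h).2.1⟩

/-- Not a case of `Represents.relCyl_cons`: that would need a representative of `C(ω, ω)`, the whole
subshift, which need not exist. The vertex `r(e)` takes its place. -/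
theorem Represents.edge_mul_ghost (e : E) :
    Represents R 𝓔 (relCyl 𝓔.edgeSubshift [] [e]) (edge R 𝓔 e * ghost R 𝓔 e) := by
  refine ⟨1, ?_⟩
  convert corner_mem_diagLevel (vertexPair_mem_diagLevel (R := R) (𝓔 := 𝓔) 0 (𝓔.rng e)) e using 1
  refine Prod.ext ?_ ?_
  · ext y
    rw [corner_fst, shiftFun_apply]
    dsimp only
    by_cases hy : y ∈ 𝓔.edgeSubshift ∧ y.head = e
    · have : y.tail ∈ 𝓔.pathsFrom (𝓔.rng e) :=
        ⟨𝓔.tail_mem_edgeSubshift hy.1, by rw [𝓔.src_head_tail hy.1, hy.2]⟩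
      rw [if_pos hy, Set.indicator_of_mem (𝓔.mem_relCyl_nil_singleton.2 hy)]
      simp [vertexPair, this]
    · rw [if_neg hy, Set.indicator_of_notMem]
      exact fun h => hy (𝓔.mem_relCyl_nil_singleton.1 h)
  · rw [corner_snd]
    simp only [vertexPair]
    rw [rng_mul_ghost]

end LeavittPathAlg

/-! ### Products over words. -/

section WordProd

variable {𝒜 S T : Type*}

theorem wordProd_singleton [Mul S] [Zero S] (f : 𝒜 → S) (a : 𝒜) : wordProd f [a] = f a := rfl

theorem wordProd_cons [Mul S] [Zero S] (f : 𝒜 → S) (a : 𝒜) {l : List 𝒜} (hl : l ≠ []) :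
    wordProd f (a :: l) = f a * wordProd f l := by
  cases l with
  | nil => exact absurd rfl hl
  | cons b l => rfl

theorem wordProd_concat [SemigroupWithZero S] (f : 𝒜 → S) (a : 𝒜) {l : List 𝒜} (hl : l ≠ []) :
    wordProd f (l ++ [a]) = wordProd f l * f a := by
  induction l with
  | nil => exact absurd rfl hl
  | cons b l ih =>
    rcases eq_or_ne l [] with rfl | hl'
    · rfl
    · rw [List.cons_append, wordProd_cons _ _ (by simp), ih hl', wordProd_cons _ _ hl', mul_assoc]

theorem wordProd_reverse_cons [SemigroupWithZero S] (f : 𝒜 → S) (a : 𝒜) {l : List 𝒜}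
    (hl : l ≠ []) : wordProd f (a :: l).reverse = wordProd f l.reverse * f a := by
  rw [List.reverse_cons, wordProd_concat _ _ (by simpa using hl)]

theorem map_wordProd [NonUnitalNonAssocSemiring S] [NonUnitalNonAssocSemiring T] {F : Type*}
    [FunLike F S T] [NonUnitalRingHomClass F S T] (φ : F) (f : 𝒜 → S) (l : List 𝒜) :
    φ (wordProd f l) = wordProd (fun a => φ (f a)) l := by
  induction l with
  | nil => exact map_zero φ
  | cons a l ih =>
    rcases eq_or_ne l [] with rfl | hl
    · rfl
    · rw [wordProd_cons _ _ hl, wordProd_cons _ _ hl, map_mul, ih]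

end WordProd

theorem FreeNonUnitalAlg.lift_of {R G S : Type*} [CommRing R] [NonUnitalRing S] [Module R S]
    [IsScalarTower R S S] [SMulCommClass R S S] (f : G → S) (g : G) :
    MonoidAlgebra.liftMagma R (FreeSemigroup.lift f) (FreeNonUnitalAlg.of R g) = f g := by
  simp [FreeNonUnitalAlg.of]

/-! ### Every set in the Boolean algebra is represented. -/

namespace LeavittPathAlg

variable {R : Type*} [CommRing R] {V E : Type*} {𝓔 : DirGraph V E}

/-- The product telescopes from the inside: `e^* e = r(e) = s(f)` is absorbed by the next edge `f`.
The vertex that remains is the range of the last edge. -/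
theorem exists_ghostWord_mul_edgeWord {α : List E}
    (hα : α.IsChain fun e f => 𝓔.rng e = 𝓔.src f) (h0 : α ≠ []) :
    ∃ v, relCyl 𝓔.edgeSubshift α [] = 𝓔.pathsFrom v ∧
      wordProd (ghost R 𝓔) α.reverse * wordProd (edge R 𝓔) α = vertex R 𝓔 v := by
  induction α with
  | nil => exact absurd rfl h0
  | cons e l ih =>
    cases l with
    | nil => exact ⟨𝓔.rng e, 𝓔.relCyl_cons_nil, ghost_mul_edge R 𝓔 e⟩
    | cons f l =>
      rw [List.isChain_cons_cons] at hα
      obtain ⟨v, hv, hv'⟩ := ih hα.2 (by simp)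
      refine ⟨v, (𝓔.relCyl_cons_cons_nil hα.1 []).trans hv, ?_⟩
      have hsrc : vertex R 𝓔 (𝓔.src f) * wordProd (edge R 𝓔) (f :: l) =
          wordProd (edge R 𝓔) (f :: l) := by
        rcases eq_or_ne l [] with rfl | hl
        · exact src_mul_edge R 𝓔 f
        · rw [wordProd_cons _ _ hl, ← mul_assoc, src_mul_edge]
      rw [wordProd_reverse_cons _ _ (by simp), wordProd_cons _ e (by simp), mul_assoc,
        ← mul_assoc (ghost R 𝓔 e), ghost_mul_edge, hα.1, hsrc, hv']

theorem Represents.follower {α : List E} (hα : α ∈ language 𝓔.edgeSubshift) (h0 : α ≠ []) :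
    Represents R 𝓔 (relCyl 𝓔.edgeSubshift α [])
      (wordProd (ghost R 𝓔) α.reverse * wordProd (edge R 𝓔) α) := by
  obtain ⟨v, hv, hv'⟩ := exists_ghostWord_mul_edgeWord (R := R) (𝓔.isChain_of_mem_language hα) h0
  rw [hv, hv']
  exact Represents.vertex v

theorem Represents.cylinder {β : List E} (h0 : β ≠ []) :
    Represents R 𝓔 (relCyl 𝓔.edgeSubshift [] β)
      (wordProd (edge R 𝓔) β * wordProd (ghost R 𝓔) β.reverse) := by
  induction β with
  | nil => exact absurd rfl h0
  | cons e l ih =>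
    rcases eq_or_ne l [] with rfl | hl
    · exact Represents.edge_mul_ghost e
    · rw [wordProd_cons _ _ hl, wordProd_reverse_cons _ _ hl]
      simpa only [mul_assoc] using (ih hl).relCyl_cons e

theorem Represents.conj {α β : List E} {d : LeavittPathAlg R 𝓔}
    (h : Represents R 𝓔 (relCyl 𝓔.edgeSubshift α []) d) (h0 : β ≠ []) :
    Represents R 𝓔 (relCyl 𝓔.edgeSubshift α β)
      (wordProd (edge R 𝓔) β * d * wordProd (ghost R 𝓔) β.reverse) := by
  induction β with
  | nil => exact absurd rfl h0
  | cons e l ih =>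
    rcases eq_or_ne l [] with rfl | hl
    · rw [List.reverse_singleton, wordProd_singleton, wordProd_singleton, mul_assoc]
      exact h.relCyl_cons e
    · rw [wordProd_cons _ _ hl, wordProd_reverse_cons _ _ hl]
      simpa only [mul_assoc] using (ih hl).relCyl_cons e

theorem exists_represents {A : Set (Stream' E)} (hA : MemB 𝓔.edgeSubshift A) :
    ∃ d, Represents R 𝓔 A d := by
  induction hA with
  | relCyl α β hα hβ h =>
    rcases eq_or_ne β [] with rfl | hβ'
    · exact ⟨_, Represents.follower hα fun h' => h ⟨h', rfl⟩⟩
    · rcases eq_or_ne α [] with rfl | hα'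
      · exact ⟨_, Represents.cylinder hβ'⟩
      · exact ⟨_, (Represents.follower hα hα').conj hβ'⟩
  | empty => exact ⟨_, Represents.empty⟩
  | union A B _ _ ihA ihB =>
    obtain ⟨d, hd⟩ := ihA
    obtain ⟨d', hd'⟩ := ihB
    exact ⟨_, hd.union hd'⟩
  | inter A B _ _ ihA ihB =>
    obtain ⟨d, hd⟩ := ihA
    obtain ⟨d', hd'⟩ := ihB
    exact ⟨_, hd.inter hd'⟩
  | diff A B _ _ ihA ihB =>
    obtain ⟨d, hd⟩ := ihA
    obtain ⟨d', hd'⟩ := ihB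
    exact ⟨_, hd.diff hd'⟩

end LeavittPathAlg

/-! ### Identities in the subshift algebra. -/

namespace SubshiftAlg

section General

variable (R : Type*) [CommRing R] {𝒜 : Type*} (X : Set (Stream' 𝒜))

/-- The generator `p_A` of the subshift algebra. -/
noncomputable def proj (A : Set (Stream' 𝒜)) (hA : MemB X A) : SubshiftAlg R X :=
  UniversalAlg.gen (Rel R X) (SubshiftGen.p A hA)

/-- The generator `s_a` of the subshift algebra. -/
noncomputable def iso (a : 𝒜) : SubshiftAlg R X :=
  UniversalAlg.gen (Rel R X) (SubshiftGen.s a)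

/-- The generator `s_a^*` of the subshift algebra. -/
noncomputable def isoStar (a : 𝒜) : SubshiftAlg R X :=
  UniversalAlg.gen (Rel R X) (SubshiftGen.sStar a)

theorem mk_P (A : Set (Stream' 𝒜)) (hA : MemB X A) :
    UniversalAlg.mk (Rel R X) (P R X A hA) = proj R X A hA := rfl

theorem mk_s (a : 𝒜) : UniversalAlg.mk (Rel R X) (s R X a) = iso R X a := rfl

theorem mk_sStar (a : 𝒜) : UniversalAlg.mk (Rel R X) (sStar R X a) = isoStar R X a := rfl

theorem mk_sWord (α : List 𝒜) :
    UniversalAlg.mk (Rel R X) (sWord R X α) = wordProd (iso R X) α :=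
  map_wordProd _ _ _

theorem mk_sStarWord (α : List 𝒜) :
    UniversalAlg.mk (Rel R X) (sStarWord R X α) = wordProd (isoStar R X) α.reverse :=
  map_wordProd _ _ _

variable {X}

theorem proj_congr {A B : Set (Stream' 𝒜)} (h : A = B) (hA : MemB X A) :
    proj R X A hA = proj R X B (h ▸ hA) := by
  subst h
  rfl

theorem proj_mul {A B : Set (Stream' 𝒜)} (hA : MemB X A) (hB : MemB X B) :
    proj R X A hA * proj R X B hB = proj R X (A ∩ B) (hA.inter A B hB) := by
  simpa only [mk_P, map_mul] using
    (UniversalAlg.mk_eq_of_rel _ (Rel.p_inter (R := R) A B hA hB)).symm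

theorem proj_union {A B : Set (Stream' 𝒜)} (hA : MemB X A) (hB : MemB X B) :
    proj R X (A ∪ B) (hA.union A B hB) =
      proj R X A hA + proj R X B hB - proj R X (A ∩ B) (hA.inter A B hB) := by
  simpa only [mk_P, map_add, map_sub] using
    UniversalAlg.mk_eq_of_rel _ (Rel.p_union (R := R) A B hA hB)

theorem proj_empty : proj R X ∅ MemB.empty = 0 := by
  simpa only [mk_P, map_zero] using UniversalAlg.mk_eq_of_rel _ (Rel.p_empty (R := R) (X := X))

theorem proj_union_of_disjoint {A B : Set (Stream' 𝒜)} (hA : MemB X A) (hB : MemB X B)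
    (h : A ∩ B = ∅) :
    proj R X (A ∪ B) (hA.union A B hB) = proj R X A hA + proj R X B hB := by
  rw [proj_union, proj_congr R h, proj_empty, sub_zero]

/-- The defining relations do not mention relative complements; the formula comes from the disjoint
decomposition of `A` into `A \ B` and `A ∩ B`. -/
theorem proj_diff {A B : Set (Stream' 𝒜)} (hA : MemB X A) (hB : MemB X B) :
    proj R X (A \ B) (hA.diff A B hB) = proj R X A hA - proj R X A hA * proj R X B hB := by
  have h := proj_union_of_disjoint R (hA.diff A B hB) (hA.inter A B hB)
    (by ext; simp +contextual)
  rw [proj_congr R (Set.sdiff_union_inter A B)] at h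
  rw [proj_mul, h, add_sub_cancel_right]

theorem iso_mul_isoStar_mul_iso (a : 𝒜) : iso R X a * isoStar R X a * iso R X a = iso R X a := by
  simpa only [mk_s, mk_sStar, map_mul] using
    UniversalAlg.mk_eq_of_rel _ (Rel.s_sStar_s (R := R) (X := X) a)

theorem isoStar_mul_iso_mul_isoStar (a : 𝒜) :
    isoStar R X a * iso R X a * isoStar R X a = isoStar R X a := by
  simpa only [mk_s, mk_sStar, map_mul] using
    UniversalAlg.mk_eq_of_rel _ (Rel.sStar_s_sStar (R := R) (X := X) a)

theorem proj_relCyl (α β : List 𝒜) (hα : α ∈ language X) (hβ : β ∈ language X)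
    (hα' : α ≠ []) (hβ' : β ≠ []) :
    proj R X (relCyl X α β) (MemB.relCyl α β hα hβ fun h => hα' h.1) =
      wordProd (iso R X) β * wordProd (isoStar R X) α.reverse * wordProd (iso R X) α *
        wordProd (isoStar R X) β.reverse := by
  simpa only [mk_P, mk_sWord, mk_sStarWord, map_mul] using
    (UniversalAlg.mk_eq_of_rel _ (Rel.p_relCyl (R := R) α β hα hβ hα' hβ')).symm

theorem proj_follower (α : List 𝒜) (hα : α ∈ language X) (h0 : [] ∈ language X)
    (hα' : α ≠ []) :
    proj R X (relCyl X α []) (MemB.relCyl α [] hα h0 fun h => hα' h.1) =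
      wordProd (isoStar R X) α.reverse * wordProd (iso R X) α := by
  simpa only [mk_P, mk_sWord, mk_sStarWord, map_mul] using
    (UniversalAlg.mk_eq_of_rel _ (Rel.p_follower (R := R) α hα h0 hα')).symm

theorem proj_cylinder (β : List 𝒜) (hβ : β ∈ language X) (h0 : [] ∈ language X)
    (hβ' : β ≠ []) :
    proj R X (relCyl X [] β) (MemB.relCyl [] β h0 hβ fun h => hβ' h.2) =
      wordProd (iso R X) β * wordProd (isoStar R X) β.reverse := by
  simpa only [mk_P, mk_sWord, mk_sStarWord, map_mul] using
    (UniversalAlg.mk_eq_of_rel _ (Rel.p_cylinder (R := R) β hβ h0 hβ')).symm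

variable {R}

/-- An endomorphism that fixes all `s_a` and `s_a^*` fixes all `p_A`. -/
theorem hom_proj_eq {θ : SubshiftAlg R X →ₙₐ[R] SubshiftAlg R X}
    (hs : ∀ a, θ (iso R X a) = iso R X a) (hs' : ∀ a, θ (isoStar R X a) = isoStar R X a)
    {A : Set (Stream' 𝒜)} (hA : MemB X A) : θ (proj R X A hA) = proj R X A hA := by
  have hw : ∀ α, θ (wordProd (iso R X) α) = wordProd (iso R X) α := fun α => by
    rw [map_wordProd]
    simp only [hs]
  have hw' : ∀ α, θ (wordProd (isoStar R X) α) = wordProd (isoStar R X) α := fun α => by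
    rw [map_wordProd]
    simp only [hs']
  -- For `C(α, β)` the projection is a word in the `s_a` and `s_a^*`, and Boolean operations are
  -- polynomial in the projections.
  induction hA with
  | relCyl α β hα hβ h =>
    rcases eq_or_ne β [] with rfl | hβ'
    · rw [proj_follower R α hα hβ fun h' => h ⟨h', rfl⟩, map_mul, hw, hw']
    · rcases eq_or_ne α [] with rfl | hα'
      · rw [proj_cylinder R β hβ hα hβ', map_mul, hw, hw']
      · rw [proj_relCyl R α β hα hβ hα' hβ', map_mul, map_mul, map_mul, hw, hw, hw', hw']
  | empty => rw [proj_empty, map_zero]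
  | union A B hA hB ihA ihB => rw [proj_union, ← proj_mul, map_sub, map_add, map_mul, ihA, ihB]
  | inter A B hA hB ihA ihB => rw [← proj_mul, map_mul, ihA, ihB]
  | diff A B hA hB ihA ihB => rw [proj_diff, map_sub, map_mul, ihA, ihB]

end General

/-! ### The homomorphisms in the two directions. -/

variable {R : Type*} [CommRing R] {V E : Type*} {𝓔 : DirGraph V E}

open LeavittPathAlg in
theorem exists_hom_leavittPathAlg (hsink : ∀ v, ¬ 𝓔.IsSink v) :
    ∃ φ : SubshiftAlg R 𝓔.edgeSubshift →ₙₐ[R] LeavittPathAlg R 𝓔,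
      (∀ A hA, Represents R 𝓔 A (φ (proj R _ A hA))) ∧
      (∀ e, φ (iso R _ e) = edge R 𝓔 e) ∧ ∀ e, φ (isoStar R _ e) = ghost R 𝓔 e := by
  -- The choice of representatives is harmless: by uniqueness, a relation holds as soon as both
  -- sides represent the same set.
  choose d hd using fun (A : Set (Stream' E)) (hA : MemB 𝓔.edgeSubshift A) =>
    exists_represents (R := R) hA
  let f : SubshiftGen 𝓔.edgeSubshift → LeavittPathAlg R 𝓔
    | .p A hA => d A hA
    | .s e => edge R 𝓔 e
    | .sStar e => ghost R 𝓔 e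
  let F := MonoidAlgebra.liftMagma R (FreeSemigroup.lift f)
  have hp : ∀ A hA, F (P R _ A hA) = d A hA := fun A hA => FreeNonUnitalAlg.lift_of f _
  have hs : ∀ e, F (s R _ e) = edge R 𝓔 e := fun e => FreeNonUnitalAlg.lift_of f _
  have hs' : ∀ e, F (sStar R _ e) = ghost R 𝓔 e := fun e => FreeNonUnitalAlg.lift_of f _
  have hw : ∀ α, F (sWord R _ α) = wordProd (edge R 𝓔) α := fun α => by
    rw [sWord, map_wordProd]
    simp only [hs]
  have hw' : ∀ α, F (sStarWord R _ α) = wordProd (ghost R 𝓔) α.reverse := fun α => by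
    rw [sStarWord, map_wordProd]
    simp only [hs']
  obtain ⟨φ, hφ⟩ := UniversalAlg.exists_lift (Rel R 𝓔.edgeSubshift) f (fun x y hxy => by
    change F x = F y
    induction hxy with
    | p_inter A B hA hB =>
      rw [map_mul, hp, hp, hp]
      exact (hd _ _).unique hsink ((hd _ _).inter (hd _ _))
    | p_union A B hA hB =>
      rw [map_sub, map_add, hp, hp, hp, hp,
        (hd _ (hA.inter A B hB)).unique hsink ((hd _ hA).inter (hd _ hB))]
      exact (hd _ _).unique hsink ((hd _ _).union (hd _ _))
    | p_empty =>
      rw [map_zero, hp]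
      exact (hd _ _).unique hsink Represents.empty
    | s_sStar_s e =>
      rw [map_mul, map_mul, hs, hs', mul_assoc, ghost_mul_edge, edge_mul_rng]
    | sStar_s_sStar e =>
      rw [map_mul, map_mul, hs, hs', ghost_mul_edge, rng_mul_ghost]
    | p_relCyl α β hα hβ hα' hβ' =>
      rw [map_mul, map_mul, map_mul, hp, hw, hw, hw', hw', mul_assoc (wordProd (edge R 𝓔) β)]
      exact ((Represents.follower hα hα').conj hβ').unique hsink (hd _ _)
    | p_follower α hα h0 hα' =>
      rw [map_mul, hp, hw, hw']
      exact (Represents.follower hα hα').unique hsink (hd _ _)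
    | p_cylinder β hβ h0 hβ' =>
      rw [map_mul, hp, hw, hw']
      exact (Represents.cylinder hβ').unique hsink (hd _ _))
  refine ⟨φ, fun A hA => ?_, fun e => hφ _, fun e => hφ _⟩
  have : φ (proj R _ A hA) = d A hA := hφ _
  rw [this]
  exact hd A hA

theorem singleton_mem_language (hsink : ∀ v, ¬ 𝓔.IsSink v) (e : E) :
    [e] ∈ language 𝓔.edgeSubshift := by
  obtain ⟨x, hx⟩ := 𝓔.pathsFrom_nonempty hsink (𝓔.rng e)
  exact ⟨Stream'.cons e x, 𝓔.cons_mem_edgeSubshift hx, 1, rfl⟩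

/-- An edge has to be given: a graph without edges has an empty subshift, and then even `ω` is not
in the language. -/
theorem nil_mem_language (hsink : ∀ v, ¬ 𝓔.IsSink v) (e : E) : [] ∈ language 𝓔.edgeSubshift := by
  obtain ⟨x, hx, -⟩ := singleton_mem_language hsink e
  exact ⟨x, hx, 0, rfl⟩

theorem memB_relCyl_nil_singleton (hsink : ∀ v, ¬ 𝓔.IsSink v) (e : E) :
    MemB 𝓔.edgeSubshift (relCyl 𝓔.edgeSubshift [] [e]) :=
  MemB.relCyl [] [e] (nil_mem_language hsink e) (singleton_mem_language hsink e) (by simp)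

theorem proj_relCyl_nil_singleton (hsink : ∀ v, ¬ 𝓔.IsSink v) (e : E) :
    proj R _ _ (memB_relCyl_nil_singleton hsink e) =
      iso R 𝓔.edgeSubshift e * isoStar R 𝓔.edgeSubshift e :=
  proj_cylinder R [e] (singleton_mem_language hsink e) (nil_mem_language hsink e) (by simp)

theorem memB_pathsFrom_rng (hsink : ∀ v, ¬ 𝓔.IsSink v) (e : E) :
    MemB 𝓔.edgeSubshift (𝓔.pathsFrom (𝓔.rng e)) :=
  𝓔.relCyl_cons_nil ▸
    MemB.relCyl [e] [] (singleton_mem_language hsink e) (nil_mem_language hsink e) (by simp)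

theorem proj_pathsFrom_rng (hsink : ∀ v, ¬ 𝓔.IsSink v) (e : E) :
    proj R _ _ (memB_pathsFrom_rng hsink e) =
      isoStar R 𝓔.edgeSubshift e * iso R 𝓔.edgeSubshift e :=
  (proj_congr R 𝓔.relCyl_cons_nil _).symm.trans
    (proj_follower R [e] (singleton_mem_language hsink e) (nil_mem_language hsink e) (by simp))

/-- Cylinders of distinct edges are disjoint, so their projections add up. The membership serves
sources that emit finitely many edges; the formula gives (CK2). -/
theorem exists_proj_head_mem (hsink : ∀ v, ¬ 𝓔.IsSink v) (F : Finset E) :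
    ∃ h : MemB 𝓔.edgeSubshift {x | x ∈ 𝓔.edgeSubshift ∧ x.head ∈ F},
      proj R _ _ h = ∑ e ∈ F, iso R 𝓔.edgeSubshift e * isoStar R 𝓔.edgeSubshift e := by
  classical
  induction F using Finset.induction_on with
  | empty =>
    have h0 : (∅ : Set (Stream' E)) = {x | x ∈ 𝓔.edgeSubshift ∧ x.head ∈ (∅ : Finset E)} := by
      ext
      simp
    exact ⟨h0 ▸ MemB.empty, (proj_congr R h0 MemB.empty).symm.trans (proj_empty R)⟩
  | insert e F he ih =>
    obtain ⟨h, hF⟩ := ih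
    have hu : relCyl 𝓔.edgeSubshift [] [e] ∪ {x | x ∈ 𝓔.edgeSubshift ∧ x.head ∈ F} =
        {x | x ∈ 𝓔.edgeSubshift ∧ x.head ∈ insert e F} := by
      ext x
      simp only [Set.mem_union, 𝓔.mem_relCyl_nil_singleton, Set.mem_ofPred_eq, Finset.mem_insert]
      tauto
    have hd : relCyl 𝓔.edgeSubshift [] [e] ∩ {x | x ∈ 𝓔.edgeSubshift ∧ x.head ∈ F} = ∅ := by
      refine Set.eq_empty_of_forall_notMem ?_
      rintro x ⟨hx, -, hx'⟩
      rw [𝓔.mem_relCyl_nil_singleton] at hx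
      exact he (hx.2 ▸ hx')
    have hm := (memB_relCyl_nil_singleton hsink e).union _ _ h
    refine ⟨hu ▸ hm, (proj_congr R hu hm).symm.trans ?_⟩
    rw [proj_union_of_disjoint R (memB_relCyl_nil_singleton hsink e) h hd, hF,
      Finset.sum_insert he, proj_relCyl_nil_singleton hsink]

theorem setOf_head_mem_eq_pathsFrom {v : V} (hfin : {e | 𝓔.src e = v}.Finite) :
    {x | x ∈ 𝓔.edgeSubshift ∧ x.head ∈ hfin.toFinset} = 𝓔.pathsFrom v := by
  ext x
  simp [DirGraph.pathsFrom]

theorem memB_pathsFrom (hsink : ∀ v, ¬ 𝓔.IsSink v)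
    (hsource : ∀ v, ¬ (𝓔.IsSource v ∧ 𝓔.IsInfiniteEmitter v)) (v : V) :
    MemB 𝓔.edgeSubshift (𝓔.pathsFrom v) := by
  by_cases hv : 𝓔.IsSource v
  · have hfin : {e | 𝓔.src e = v}.Finite := by
      by_contra h
      exact hsource v ⟨hv, h⟩
    -- Only the membership is kept, so any coefficient ring would do.
    obtain ⟨h, -⟩ := exists_proj_head_mem (R := ℤ) hsink hfin.toFinset
    exact setOf_head_mem_eq_pathsFrom hfin ▸ h
  · obtain ⟨e, rfl⟩ : ∃ e, 𝓔.rng e = v := by simpa [DirGraph.IsSource] using hv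
    exact memB_pathsFrom_rng hsink e

theorem relCyl_nil_singleton_subset (e : E) :
    relCyl 𝓔.edgeSubshift [] [e] ⊆ 𝓔.pathsFrom (𝓔.src e) := fun x hx => by
  rw [𝓔.mem_relCyl_nil_singleton] at hx
  exact ⟨hx.1, by rw [hx.2]⟩

theorem exists_hom_of_leavittPathAlg (hsink : ∀ v, ¬ 𝓔.IsSink v)
    (hsource : ∀ v, ¬ (𝓔.IsSource v ∧ 𝓔.IsInfiniteEmitter v)) :
    ∃ ψ : LeavittPathAlg R 𝓔 →ₙₐ[R] SubshiftAlg R 𝓔.edgeSubshift,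
      (∀ v, ψ (LeavittPathAlg.vertex R 𝓔 v) = proj R _ _ (memB_pathsFrom hsink hsource v)) ∧
      (∀ e, ψ (LeavittPathAlg.edge R 𝓔 e) = iso R _ e) ∧
      ∀ e, ψ (LeavittPathAlg.ghost R 𝓔 e) = isoStar R _ e := by
  let f : LeavittGen V E → SubshiftAlg R 𝓔.edgeSubshift
    | .vertex v => proj R _ _ (memB_pathsFrom hsink hsource v)
    | .edge e => iso R _ e
    | .ghost e => isoStar R _ e
  let F := MonoidAlgebra.liftMagma R (FreeSemigroup.lift f)
  have hv : ∀ v, F (LeavittPathAlg.vx R v) = proj R _ _ (memB_pathsFrom hsink hsource v) :=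
    fun v => FreeNonUnitalAlg.lift_of f _
  have he : ∀ e, F (LeavittPathAlg.ed R e) = iso R _ e := fun e => FreeNonUnitalAlg.lift_of f _
  have hg : ∀ e, F (LeavittPathAlg.gh R e) = isoStar R _ e :=
    fun e => FreeNonUnitalAlg.lift_of f _
  obtain ⟨ψ, hψ⟩ := UniversalAlg.exists_lift (LeavittPathAlg.Rel R 𝓔) f (fun x y hxy => by
    change F x = F y
    induction hxy with
    | v_same v => rw [map_mul, hv, proj_mul, proj_congr R (Set.inter_self _)]
    | v_ne v w h =>
      have hd : 𝓔.pathsFrom v ∩ 𝓔.pathsFrom w = ∅ :=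
        Set.eq_empty_of_forall_notMem fun x hx => h (hx.1.2.symm.trans hx.2.2)
      rw [map_mul, map_zero, hv, hv, proj_mul, proj_congr R hd, proj_empty]
    | src_mul_edge e =>
      -- Writing `s_e = p_{C(ω, e)} s_e` reduces the claim to the inclusion of `C(ω, e)` in the set
      -- of paths from `s(e)`.
      rw [map_mul, hv, he, ← iso_mul_isoStar_mul_iso, ← proj_relCyl_nil_singleton hsink,
        ← mul_assoc, proj_mul,
        proj_congr R (Set.inter_eq_right.2 (relCyl_nil_singleton_subset e))]
    | edge_mul_rng e =>
      rw [map_mul, hv, he, proj_pathsFrom_rng hsink, ← mul_assoc, iso_mul_isoStar_mul_iso]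
    | rng_mul_ghost e =>
      rw [map_mul, hv, hg, proj_pathsFrom_rng hsink, isoStar_mul_iso_mul_isoStar]
    | ghost_mul_src e =>
      rw [map_mul, hv, hg, ← isoStar_mul_iso_mul_isoStar, mul_assoc (isoStar R _ e),
        ← proj_relCyl_nil_singleton hsink, mul_assoc, proj_mul,
        proj_congr R (Set.inter_eq_left.2 (relCyl_nil_singleton_subset e))]
    | ck1_same e => rw [map_mul, hv, he, hg, proj_pathsFrom_rng hsink]
    | ck1_ne e e' h =>
      have hd : relCyl 𝓔.edgeSubshift [] [e] ∩ relCyl 𝓔.edgeSubshift [] [e'] = ∅ := by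
        refine Set.eq_empty_of_forall_notMem fun x hx => h ?_
        rw [Set.mem_inter_iff, 𝓔.mem_relCyl_nil_singleton, 𝓔.mem_relCyl_nil_singleton] at hx
        exact hx.1.2.symm.trans hx.2.2
      -- Relation (ii) inserts the projections of the cylinders of `e` and `e'` between `s_e^*` and
      -- `s_{e'}`; these cylinders are disjoint.
      rw [map_mul, map_zero, he, hg, ← isoStar_mul_iso_mul_isoStar R e,
        ← iso_mul_isoStar_mul_iso R e', mul_assoc (isoStar R _ e), ← proj_relCyl_nil_singleton hsink,
        ← proj_relCyl_nil_singleton hsink, mul_assoc, ← mul_assoc (proj R _ _ _), proj_mul,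
        proj_congr R hd, proj_empty, zero_mul, mul_zero]
    | ck2 v hne hfin =>
      obtain ⟨h, hsum⟩ := exists_proj_head_mem (R := R) hsink hfin.toFinset
      rw [map_sum, hv]
      simp only [map_mul, he, hg]
      rw [← hsum, proj_congr R (setOf_head_mem_eq_pathsFrom hfin)])
  exact ⟨ψ, fun v => hψ _, fun e => hψ _, fun e => hψ _⟩

end SubshiftAlg

/-! ### The two homomorphisms are mutually inverse. -/

theorem mainTheorem9 {R : Type*} [CommRing R] {V E : Type*} (𝓔 : DirGraph V E)
    (hsink : ∀ v, ¬ 𝓔.IsSink v)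
    (hsource : ∀ v, ¬ (𝓔.IsSource v ∧ 𝓔.IsInfiniteEmitter v)) :
    ∃ φ : SubshiftAlg R 𝓔.edgeSubshift →ₙₐ[R] LeavittPathAlg R 𝓔, Function.Bijective φ := by
  obtain ⟨φ, hφp, hφs, hφs'⟩ := SubshiftAlg.exists_hom_leavittPathAlg (R := R) hsink
  obtain ⟨ψ, hψv, hψe, hψg⟩ := SubshiftAlg.exists_hom_of_leavittPathAlg (R := R) hsink hsource
  have hs : ∀ e, (ψ.comp φ) (SubshiftAlg.iso R _ e) = SubshiftAlg.iso R _ e := fun e => by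
    rw [NonUnitalAlgHom.comp_apply, hφs, hψe]
  have hs' : ∀ e, (ψ.comp φ) (SubshiftAlg.isoStar R _ e) = SubshiftAlg.isoStar R _ e := fun e => by
    rw [NonUnitalAlgHom.comp_apply, hφs', hψg]
  have h1 : ψ.comp φ = NonUnitalAlgHom.id R _ := UniversalAlg.hom_ext _ fun g => by
    cases g with
    | p A hA => exact SubshiftAlg.hom_proj_eq hs hs' hA
    | s e => exact hs e
    | sStar e => exact hs' e
  have h2 : φ.comp ψ = NonUnitalAlgHom.id R _ := UniversalAlg.hom_ext _ fun g => by
    cases g with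
    | vertex v =>
      -- The image of `v` under the composite represents the set of paths from `v`, and so does `v`
      -- itself.
      refine (congrArg φ (hψv v)).trans ?_
      exact (hφp _ _).unique hsink (LeavittPathAlg.Represents.vertex v)
    | edge e => exact (congrArg φ (hψe e)).trans (hφs e)
    | ghost e => exact (congrArg φ (hψg e)).trans (hφs' e)
  exact ⟨φ, Function.bijective_iff_has_inverse.2
    ⟨ψ, fun x => DFunLike.congr_fun h1 x, fun x => DFunLike.congr_fun h2 x⟩⟩
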